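/- Let $S$ be a surface in Monge form $\phi(u,v)=(u,v,f(u,v))$, where $f$ is a $C^\infty$ function near the origin of $\mathbb R^2$ with $$f(u,v)=\tfrac12(\kappa_1u^2+\kappa_2v^2)+\sum_{i+j\ge 3}^{k}\frac{a_{ij}}{i!\,j!}u^iv^j+O(k+1)$$ (so $a_{ij}=\partial_u^i\partial_v^j f(0,0)$ for $i+j\ge3$, and $\kappa_1,\kappa_2$ are the principal curvatures at the origin), and suppose $\kappa_2\neq 0$ (in particular the origin is not a flat umbilic). Let $0<\alpha<\pi/2$. Let $N=\phi_u\times\phi_v/\|\phi_u\times\phi_v\|$, let $E=\langle\phi_u,\phi_u\rangle$, $G=\langle\phi_v,\phi_v\rangle$, $g=\langle\phi_{vv},N\rangle$, and let $\mathcal E_1$ be the evolutoid of $S$ in this parametrization, $$\mathcal E_1=\phi+r\Bigl(\frac{\cos\alpha}{\sqrt E}\,\phi_u+\sin\alpha\,N\Bigr),\qquad r=-\frac{2\sqrt E\,G}{\cos\alpha\,G_u-2\sin\alpha\,\sqrt E\,G\cdot (g/G)} .$$ Suppose that $\mathcal E_1$ is regular (an immersion) at $(0,0)$, put $p=\mathcal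 E_1(0,0)$, and let $\psi(s,t)=p+(s,\tilde g(s,t),t)$, with $\tilde g$ smooth near the origin and $\tilde g(0,0)=\tilde g_s(0,0)=\tilde g_t(0,0)=0$, be the Monge form parametrization at $p=\psi(0,0)$ of the surface germ parametrized by $\mathcal E_1$ near $(0,0)$. Suppose that $p$ is a parabolic point of this surface (its Gaussian curvature vanishes at $p$) and that $\mathbf v=(0,0,1)$ is an asymptotic direction at $p$ (a tangent direction of zero normal curvature). Then the height function $h_{N_0}(s,t)=\langle\psi(s,t),N_0\rangle$ in the normal direction $N_0=(0,1,0)$ has at the origin a singularity of type $$A_2\iff a_{31}\neq0,\qquad\qquad A_3\iff a_{31}=0\ \text{ and }\ a_{41}\ne0 .$$ Here a function germ in two variables has an $A_k$-singularity if smooth local changes of coordinates in the source and in the target bring it to the form $\pm x_1^{k+1}\pm x_2^2$. -/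

import Mathlib

open Filter Topology
open scoped Manifold ContDiff Matrix

noncomputable section

/-- Euclidean 3-space, in coordinates. Inner products are written with the standard dot product
`⬝ᵥ` and lengths as `√(w ⬝ᵥ w)`; only the topology of the function space is used otherwise. -/
abbrev Vec3 : Type := Fin 3 → ℝ

/-- `F` is of class `C^∞` on a neighbourhood of `q` (a smooth germ at `q`). -/
def SmoothNear {V W : Type*} [NormedAddCommGroup V] [NormedSpace ℝ V]
    [NormedAddCommGroup W] [NormedSpace ℝ W] (F : V → W) (q : V) : Prop :=
  ∀ᶠ x in 𝓝 q, ContDiffAt ℝ ∞ F x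

section PartialDerivatives

variable {V : Type*} [NormedAddCommGroup V] [NormedSpace ℝ V]

/-- The partial derivative `∂F/∂u`. -/
def du (F : ℝ × ℝ → V) (q : ℝ × ℝ) : V := fderiv ℝ F q (1, 0)

/-- The partial derivative `∂F/∂v`. -/
def dv (F : ℝ × ℝ → V) (q : ℝ × ℝ) : V := fderiv ℝ F q (0, 1)

end PartialDerivatives

/-- `a_{ij} = ∂^{i+j} f / ∂u^i ∂v^j (0,0)`: the numbers for which the Taylor expansion of `f` at
the origin is `∑ a_{ij} / (i! j!) u^i v^j`. -/
def taylorCoeff (f : ℝ × ℝ → ℝ) (i j : ℕ) : ℝ := (du^[i] (dv^[j] f)) (0, 0)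

/-! ### Parametrized surfaces: fundamental forms and curvature -/

/-- First fundamental form, coefficient `E`. -/
def coeffE (X : ℝ × ℝ → Vec3) (q : ℝ × ℝ) : ℝ := du X q ⬝ᵥ du X q

/-- First fundamental form, coefficient `F`. -/
def coeffF (X : ℝ × ℝ → Vec3) (q : ℝ × ℝ) : ℝ := du X q ⬝ᵥ dv X q

/-- First fundamental form, coefficient `G`. -/
def coeffG (X : ℝ × ℝ → Vec3) (q : ℝ × ℝ) : ℝ := dv X q ⬝ᵥ dv X q

/-- The unit normal `N = (X_u × X_v) / ‖X_u × X_v‖`. -/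
def unitNormal (X : ℝ × ℝ → Vec3) (q : ℝ × ℝ) : Vec3 :=
  (√(crossProduct (du X q) (dv X q) ⬝ᵥ crossProduct (du X q) (dv X q)))⁻¹ •
    crossProduct (du X q) (dv X q)

/-- Second fundamental form, coefficient `e = ⟨X_uu, N⟩`. -/
def coeffe (X : ℝ × ℝ → Vec3) (q : ℝ × ℝ) : ℝ := du (du X) q ⬝ᵥ unitNormal X q

/-- Second fundamental form, coefficient `m = ⟨X_uv, N⟩`. -/
def coeffm (X : ℝ × ℝ → Vec3) (q : ℝ × ℝ) : ℝ := du (dv X) q ⬝ᵥ unitNormal X q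

/-- Second fundamental form, coefficient `g = ⟨X_vv, N⟩`. -/
def coeffg (X : ℝ × ℝ → Vec3) (q : ℝ × ℝ) : ℝ := dv (dv X) q ⬝ᵥ unitNormal X q

/-- The parametrization `X` is regular (an immersion) at `q`. -/
def IsRegularAt (X : ℝ × ℝ → Vec3) (q : ℝ × ℝ) : Prop :=
  LinearIndependent ℝ ![du X q, dv X q]

/-- The Gaussian curvature. -/
def gaussCurvature (X : ℝ × ℝ → Vec3) (q : ℝ × ℝ) : ℝ :=
  (coeffe X q * coeffg X q - coeffm X q ^ 2) / (coeffE X q * coeffG X q - coeffF X q ^ 2)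

/-- A parabolic point of a regular surface: the Gaussian curvature vanishes. -/
def IsParabolicPoint (X : ℝ × ℝ → Vec3) (q : ℝ × ℝ) : Prop := gaussCurvature X q = 0

/-- `w` is an asymptotic direction at `X q`: a nonzero tangent vector in whose direction the
normal curvature vanishes. -/
def IsAsymptoticDirection (X : ℝ × ℝ → Vec3) (q : ℝ × ℝ) (w : Vec3) : Prop :=
  w ≠ 0 ∧ ∃ a : ℝ × ℝ, fderiv ℝ X q a = w ∧
    coeffe X q * a.1 ^ 2 + 2 * coeffm X q * a.1 * a.2 + coeffg X q * a.2 ^ 2 = 0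

/-- The height function `H(·, w)` of the surface `X`. -/
def heightFunction (X : ℝ × ℝ → Vec3) (w : Vec3) (q : ℝ × ℝ) : ℝ := X q ⬝ᵥ w

/-! ### The surface in Monge form and its evolutoid -/

/-- `φ(u,v) = (u, v, f(u,v))`. -/
def mongeSurface (f : ℝ × ℝ → ℝ) (q : ℝ × ℝ) : Vec3 := ![q.1, q.2, f q]

/-- `(u, v, f(u,v))` is a Monge form at the origin: `f` is smooth near the origin and
`f(u,v) = (κ₁ u² + κ₂ v²) / 2 + O(3)`. The principal curvatures at the origin are then
`κ₁ = taylorCoeff f 2 0` and `κ₂ = taylorCoeff f 0 2`. -/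
def IsMongeFunction (f : ℝ × ℝ → ℝ) : Prop :=
  SmoothNear f (0, 0) ∧ f (0, 0) = 0 ∧ taylorCoeff f 1 0 = 0 ∧ taylorCoeff f 0 1 = 0 ∧
    taylorCoeff f 1 1 = 0

/-- `κ₂ = g / G`. -/
def kappa2 (X : ℝ × ℝ → Vec3) (q : ℝ × ℝ) : ℝ := coeffg X q / coeffG X q

/-- `r = - 2 √E G / (cos α G_u - 2 sin α √E G κ₂)`. -/
def evolutoidRadius (X : ℝ × ℝ → Vec3) (α : ℝ) (q : ℝ × ℝ) : ℝ :=
  -(2 * √(coeffE X q) * coeffG X q) /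
    (Real.cos α * du (coeffG X) q - 2 * Real.sin α * √(coeffE X q) * coeffG X q * kappa2 X q)

/-- The evolutoid `𝓔₁ = X + r (cos α / √E X_u + sin α N)`. -/
def evolutoid (X : ℝ × ℝ → Vec3) (α : ℝ) (q : ℝ × ℝ) : Vec3 :=
  X q + evolutoidRadius X α q •
    ((Real.cos α / √(coeffE X q)) • du X q + Real.sin α • unitNormal X q)

/-- `ψ` is a parametrization in Monge form, as a graph over the `xz`-plane, of the surface
parametrized near the origin by `Y`: it is `ψ(s,t) = Y(0,0) + (s, g(s,t), t)` with `g` smooth near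
the origin and `j¹g = 0`, and it parametrizes the same surface germ as `Y`, that is, `Y = ψ ∘ θ`
near the origin for a change of parameters `θ` that fixes the origin. -/
def IsMongeParametrizationOf (Y ψ : ℝ × ℝ → Vec3) : Prop :=
  (∃ g : ℝ × ℝ → ℝ, SmoothNear g (0, 0) ∧ g (0, 0) = 0 ∧
      taylorCoeff g 1 0 = 0 ∧ taylorCoeff g 0 1 = 0 ∧
      ∀ q, ψ q = Y (0, 0) + ![q.1, g q, q.2]) ∧
    ∃ θ : ℝ × ℝ → ℝ × ℝ, θ (0, 0) = (0, 0) ∧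
      IsLocalDiffeomorphAt 𝓘(ℝ, ℝ × ℝ) 𝓘(ℝ, ℝ × ℝ) ∞ θ (0, 0) ∧
      ∀ᶠ q in 𝓝 ((0, 0) : ℝ × ℝ), Y q = ψ (θ q)

/-! ### Singularities of type `A_k` of functions of two variables -/

/-- The germ of `h₁` at `p` is `𝒜`-equivalent to the germ of `h₂` at `q`: they agree up to smooth
local changes of coordinates in the source and in the target. -/
def AEquivalentAt (h₁ : ℝ × ℝ → ℝ) (p : ℝ × ℝ) (h₂ : ℝ × ℝ → ℝ) (q : ℝ × ℝ) : Prop :=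
  ∃ (η : ℝ × ℝ → ℝ × ℝ) (ξ : ℝ → ℝ), η p = q ∧
    IsLocalDiffeomorphAt 𝓘(ℝ, ℝ × ℝ) 𝓘(ℝ, ℝ × ℝ) ∞ η p ∧
    IsLocalDiffeomorphAt 𝓘(ℝ, ℝ) 𝓘(ℝ, ℝ) ∞ ξ (h₂ q) ∧
    ∀ᶠ x in 𝓝 p, h₁ x = ξ (h₂ (η x))

/-- `h` has an `A_k`-singularity at `p`: it is `𝒜`-equivalent to `± x₁^{k+1} ± x₂²`. -/
def HasASingularity (k : ℕ) (h : ℝ × ℝ → ℝ) (p : ℝ × ℝ) : Prop :=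
  ∃ ε₁ ε₂ : ℝ, (ε₁ = 1 ∨ ε₁ = -1) ∧ (ε₂ = 1 ∨ ε₂ = -1) ∧
    AEquivalentAt h p (fun x => ε₁ * x.1 ^ (k + 1) + ε₂ * x.2 ^ 2) (0, 0)

end

/-! Everything is read off from the second coordinate `H` of the evolutoid. Since `ψ ∘ θ` is the
evolutoid, the height function of `ψ` along the `y`-axis is `𝒜`-equivalent to `H`, so the two have
the same singularity type.

For a Monge surface, `H = v - f_v K` with `K = r sin α / √(1 + f_u² + f_v²)`. Where `f_v = 0` one
has `G = 1` and `G_u = 0`, so `K = 1 / f_vv`; hence `H = v` and `H_v = 0` there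
(`evolutoid_snd_critical`). As `f_vv = κ₂ ≠ 0` at the origin, the set `f_v = 0` is a smooth curve `v
= β(u)`. Moreover `H_vv = f_vvv / f_vv` at the origin, and this is nonzero because the evolutoid
would be singular if `f_vvv = 0` (`IsMongeFunction.dv_dv_dv_ne_zero`). Hadamard's lemma along the
curve then gives `H = β(u) + (v - β(u))² Q` with `Q(0,0) ≠ 0`. So `H` is of type `A_k` as soon as
`β` vanishes to order exactly `k + 1`, that is, as soon as `f_v(u, 0)` does, and the derivatives of
`f_v(u, 0)` at `0` are the `a_{i1}` (`singularity_of_implicit_curve`).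

The Monge form gives `a_{01} = a_{11} = 0`. Parabolicity gives `a_{21} = 0`, since the Hessian is
degenerate and excludes `A_1`. The converse directions need the types to be mutually exclusive. The
invariant used is `HasSmallDifferential`: an `A_k` germ has differential of order `k`, but not `k +
1`, at points arbitrarily close to the singularity. -/

section ParametricIntegral

/-! ### Smooth dependence of integrals on parameters. -/

open MeasureTheory in
theorem hasFDerivAt_intervalIntegral_of_contDiff {V E : Type} [NormedAddCommGroup V]
    [NormedSpace ℝ V] [FiniteDimensional ℝ V] [NormedAddCommGroup E] [NormedSpace ℝ E]
    {F : V × ℝ → E} (hF : ContDiff ℝ 1 F) (x₀ : V) :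
    HasFDerivAt (fun x => ∫ s in (0 : ℝ)..1, F (x, s))
      (∫ s in (0 : ℝ)..1, (fderiv ℝ F (x₀, s)).comp (ContinuousLinearMap.inl ℝ V ℝ)) x₀ := by
  have hF' : Continuous fun p : V × ℝ => (fderiv ℝ F p).comp (ContinuousLinearMap.inl ℝ V ℝ) :=
    (hF.continuous_fderiv one_ne_zero).clm_comp continuous_const
  obtain ⟨C, hC⟩ := ((isCompact_closedBall x₀ 1).prod
    (isCompact_Icc (a := (0 : ℝ)) (b := 1))).exists_bound_of_continuousOn hF'.continuousOn
  refine intervalIntegral.hasFDerivAt_integral_of_dominated_of_fderiv_le (F := fun x s => F (x, s))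
    (F' := fun x s => (fderiv ℝ F (x, s)).comp (ContinuousLinearMap.inl ℝ V ℝ))
    (bound := fun _ => C) (Metric.closedBall_mem_nhds x₀ one_pos) ?_ ?_ ?_ ?_ ?_ ?_
  · exact .of_forall fun x =>
      (hF.continuous.comp (Continuous.prodMk_right x)).aestronglyMeasurable
  · exact (hF.continuous.comp (Continuous.prodMk_right x₀)).intervalIntegrable _ _
  · exact (hF'.comp (Continuous.prodMk_right x₀)).aestronglyMeasurable
  · refine .of_forall fun t ht x hx => hC (x, t) ⟨hx, ?_⟩
    rw [Set.uIoc_of_le zero_le_one] at ht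
    exact ⟨ht.1.le, ht.2⟩
  · exact intervalIntegrable_const
  · refine .of_forall fun t _ x _ => ?_
    exact ((hF.differentiable one_ne_zero (x, t)).hasFDerivAt).comp x
      (hasFDerivAt_prodMk_left x t)

/-- Each differentiation replaces the integrand by its partial differential, which is
operator-valued; the induction therefore has to run over all target spaces `E` at once. -/
theorem contDiff_intervalIntegral_nat {V : Type} [NormedAddCommGroup V] [NormedSpace ℝ V]
    [FiniteDimensional ℝ V] (n : ℕ) {E : Type} [NormedAddCommGroup E] [NormedSpace ℝ E]
    {F : V × ℝ → E} (hF : ContDiff ℝ ∞ F) :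
    ContDiff ℝ n (fun x => ∫ s in (0 : ℝ)..1, F (x, s)) := by
  induction n generalizing E with
  | zero =>
    have h := fun x => hasFDerivAt_intervalIntegral_of_contDiff (hF.of_le (by exact_mod_cast le_top)) x
    exact contDiff_zero.2 (continuous_iff_continuousAt.2 fun x => (h x).continuousAt)
  | succ n ih =>
    push_cast
    refine contDiff_succ_iff_hasFDerivAt.2 ⟨_, ?_, fun x =>
      hasFDerivAt_intervalIntegral_of_contDiff (hF.of_le (by exact_mod_cast le_top)) x⟩
    exact ih (F := fun p => (fderiv ℝ F p).comp (ContinuousLinearMap.inl ℝ V ℝ))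
      ((hF.fderiv_right (m := ∞) (by simp)).clm_comp contDiff_const)

theorem contDiff_intervalIntegral {V E : Type} [NormedAddCommGroup V] [NormedSpace ℝ V]
    [FiniteDimensional ℝ V] [NormedAddCommGroup E] [NormedSpace ℝ E]
    {F : V × ℝ → E} (hF : ContDiff ℝ ∞ F) :
    ContDiff ℝ ∞ (fun x => ∫ s in (0 : ℝ)..1, F (x, s)) :=
  contDiff_infty.2 fun n => contDiff_intervalIntegral_nat n hF

end ParametricIntegral

/-! ### Calculus of smooth germs. -/

section SmoothGerms

variable {V W Z : Type*} [NormedAddCommGroup V] [NormedSpace ℝ V] [NormedAddCommGroup W]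
  [NormedSpace ℝ W] [NormedAddCommGroup Z] [NormedSpace ℝ Z]

theorem SmoothNear.contDiffAt {F : V → W} {q : V} (h : SmoothNear F q) : ContDiffAt ℝ ∞ F q :=
  h.self_of_nhds

theorem SmoothNear.continuousAt {F : V → W} {q : V} (h : SmoothNear F q) : ContinuousAt F q :=
  h.contDiffAt.continuousAt

theorem SmoothNear.differentiableAt {F : V → W} {q : V} (h : SmoothNear F q) :
    DifferentiableAt ℝ F q :=
  h.contDiffAt.differentiableAt (by simp)

theorem ContDiff.smoothNear {F : V → W} (h : ContDiff ℝ ∞ F) (q : V) : SmoothNear F q :=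
  .of_forall fun _ => h.contDiffAt

theorem SmoothNear.eventually_smoothNear {F : V → W} {q : V} (h : SmoothNear F q) :
    ∀ᶠ x in 𝓝 q, SmoothNear F x :=
  eventually_eventually_nhds.2 h

protected theorem SmoothNear.congr {F G : V → W} {q : V} (h : SmoothNear F q) (hG : G =ᶠ[𝓝 q] F) :
    SmoothNear G q := by
  filter_upwards [h, eventually_eventually_nhds.2 hG] with x hx hx'
  exact hx.congr_of_eventuallyEq hx'

protected theorem SmoothNear.comp {G : W → Z} {F : V → W} {q : V} (hG : SmoothNear G (F q))
    (hF : SmoothNear F q) : SmoothNear (fun x => G (F x)) q := by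
  filter_upwards [hF, hF.continuousAt.eventually hG] with x hx hx'
  exact hx'.comp x hx

theorem SmoothNear.prodMk {F : V → W} {G : V → Z} {q : V} (hF : SmoothNear F q)
    (hG : SmoothNear G q) : SmoothNear (fun x => (F x, G x)) q := by
  filter_upwards [hF, hG] with x hx hx'
  exact hx.prodMk hx'

protected theorem SmoothNear.add {F G : V → W} {q : V} (hF : SmoothNear F q) (hG : SmoothNear G q) :
    SmoothNear (fun x => F x + G x) q := by
  filter_upwards [hF, hG] with x hx hx'
  exact hx.add hx'

protected theorem SmoothNear.sub {F G : V → W} {q : V} (hF : SmoothNear F q) (hG : SmoothNear G q) :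
    SmoothNear (fun x => F x - G x) q := by
  filter_upwards [hF, hG] with x hx hx'
  exact hx.sub hx'

protected theorem SmoothNear.neg {F : V → W} {q : V} (hF : SmoothNear F q) :
    SmoothNear (fun x => -F x) q := by
  filter_upwards [hF] with x hx
  exact hx.neg

protected theorem SmoothNear.mul {F G : V → ℝ} {q : V} (hF : SmoothNear F q) (hG : SmoothNear G q) :
    SmoothNear (fun x => F x * G x) q := by
  filter_upwards [hF, hG] with x hx hx'
  exact hx.mul hx'

protected theorem SmoothNear.pow {F : V → ℝ} {q : V} (hF : SmoothNear F q) (n : ℕ) :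
    SmoothNear (fun x => F x ^ n) q := by
  filter_upwards [hF] with x hx
  exact hx.pow n

protected theorem SmoothNear.div {F G : V → ℝ} {q : V} (hF : SmoothNear F q) (hG : SmoothNear G q)
    (h0 : G q ≠ 0) : SmoothNear (fun x => F x / G x) q := by
  filter_upwards [hF, hG, hG.continuousAt.eventually_ne h0] with x hx hx' h
  exact hx.div hx' h

protected theorem SmoothNear.sqrt {F : V → ℝ} {q : V} (hF : SmoothNear F q) (h0 : F q ≠ 0) :
    SmoothNear (fun x => √(F x)) q := by
  filter_upwards [hF, hF.continuousAt.eventually_ne h0] with x hx h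
  exact hx.sqrt h

theorem SmoothNear.rpow_const {F : V → ℝ} {q : V} (hF : SmoothNear F q) (h0 : F q ≠ 0) (a : ℝ) :
    SmoothNear (fun x => F x ^ a) q := by
  filter_upwards [hF, hF.continuousAt.eventually_ne h0] with x hx h
  exact hx.rpow_const_of_ne h

theorem smoothNear_const (c : W) (q : V) : SmoothNear (fun _ : V => c) q :=
  contDiff_const.smoothNear q

theorem smoothNear_id (q : V) : SmoothNear (fun x : V => x) q :=
  contDiff_id.smoothNear q

theorem smoothNear_fst (q : V × W) : SmoothNear (fun x : V × W => x.1) q :=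
  contDiff_fst.smoothNear q

theorem smoothNear_snd (q : V × W) : SmoothNear (fun x : V × W => x.2) q :=
  contDiff_snd.smoothNear q

protected theorem SmoothNear.fderiv {F : V → W} {q : V} (hF : SmoothNear F q) :
    SmoothNear (fderiv ℝ F) q := by
  filter_upwards [hF] with x hx
  exact hx.fderiv_right (m := ∞) (by simp)

protected theorem SmoothNear.fderiv_apply {F : V → W} {q : V} (hF : SmoothNear F q) (w : V) :
    SmoothNear (fun x => fderiv ℝ F x w) q := by
  filter_upwards [hF.fderiv] with x hx
  exact hx.clm_apply contDiffAt_const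

protected theorem SmoothNear.du {F : ℝ × ℝ → W} {q : ℝ × ℝ} (hF : SmoothNear F q) : SmoothNear (du F) q :=
  hF.fderiv_apply _

protected theorem SmoothNear.dv {F : ℝ × ℝ → W} {q : ℝ × ℝ} (hF : SmoothNear F q) : SmoothNear (dv F) q :=
  hF.fderiv_apply _

protected theorem SmoothNear.deriv {F : ℝ → W} {q : ℝ} (hF : SmoothNear F q) :
    SmoothNear (deriv F) q := hF.fderiv_apply 1

/-- A smooth germ on a finite-dimensional space extends to a globally smooth function. -/
theorem SmoothNear.exists_contDiff_eventuallyEq [FiniteDimensional ℝ V] {F : V → W} {q : V}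
    (hF : SmoothNear F q) : ∃ G : V → W, ContDiff ℝ ∞ G ∧ G =ᶠ[𝓝 q] F := by
  obtain ⟨ε, hε, hball⟩ := Metric.eventually_nhds_iff_ball.1 hF
  -- The bump is supported in the closed ball of radius `ε / 2`, inside the region where `F` is
  -- smooth, and equals `1` near `q`.
  let χ : ContDiffBump q := ⟨ε / 4, ε / 2, by positivity, by linarith⟩
  refine ⟨fun x => χ x • F x, ?_, ?_⟩
  · refine contMDiff_iff_contDiff.1 (contMDiff_of_tsupport fun x hx => ContDiffAt.contMDiffAt ?_)
    have hx' : x ∈ tsupport χ := tsupport_smul_subset_left _ _ hx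
    rw [χ.tsupport_eq] at hx'
    exact χ.contDiffAt.smul (hball x (Metric.closedBall_subset_ball (by simp [χ]; linarith) hx'))
  · filter_upwards [χ.eventuallyEq_one] with x hx
    simp [hx]

end SmoothGerms

/-! ### Hadamard's lemma and division by powers. -/

/-- Hadamard's lemma for germs of functions of two variables. -/
theorem SmoothNear.exists_eq_add_snd_mul {F : ℝ × ℝ → ℝ} {a : ℝ} (hF : SmoothNear F (a, 0)) :
    ∃ G : ℝ × ℝ → ℝ, SmoothNear G (a, 0) ∧
      ∀ᶠ q in 𝓝 ((a, 0) : ℝ × ℝ), F q = F (q.1, 0) + q.2 * G q := by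
  obtain ⟨F', hF', hFF'⟩ := hF.exists_contDiff_eventuallyEq
  have hd : ContDiff ℝ ∞ (dv F') := (hF'.fderiv_right (m := ∞) (by simp)).clm_apply contDiff_const
  -- The quotient is the mean of `∂F/∂v` over the vertical segment from `(u, 0)` to `(u, v)`, taken
  -- for the global extension so that the integrand is smooth everywhere.
  refine ⟨fun q => ∫ s in (0 : ℝ)..1, dv F' (q.1, s * q.2), ?_, ?_⟩
  · exact (contDiff_intervalIntegral (F := fun p : (ℝ × ℝ) × ℝ => dv F' (p.1.1, p.2 * p.1.2))
      (hd.comp (by fun_prop))).smoothNear _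
  · have hproj : Tendsto (fun q : ℝ × ℝ => (q.1, (0 : ℝ))) (𝓝 (a, 0)) (𝓝 (a, 0)) :=
      Continuous.tendsto' (by fun_prop) _ _ rfl
    filter_upwards [hFF', hproj.eventually hFF'] with q h1 h2
    rw [← h1, ← h2, ← intervalIntegral.integral_const_mul]
    have hderiv : ∀ s ∈ Set.uIcc (0 : ℝ) 1,
        HasDerivAt (fun s : ℝ => F' (q.1, s * q.2)) (q.2 * dv F' (q.1, s * q.2)) s := fun s _ => by
      have h := ((hF'.differentiable (by simp) (q.1, s * q.2)).hasFDerivAt).comp_hasDerivAt s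
        ((hasDerivAt_const s q.1).prodMk ((hasDerivAt_id s).mul_const q.2))
      have h2 : ((0 : ℝ), 1 * q.2) = q.2 • ((0 : ℝ), (1 : ℝ)) := by simp
      rw [h2, map_smul] at h
      exact h
    rw [intervalIntegral.integral_eq_sub_of_hasDerivAt hderiv
      (Continuous.intervalIntegrable (continuous_const.mul (hd.continuous.comp (by fun_prop))) _ _)]
    simp

theorem SmoothNear.exists_eq_mul_of_apply_zero {b : ℝ → ℝ} (hb : SmoothNear b 0) (h0 : b 0 = 0) :
    ∃ R : ℝ → ℝ, SmoothNear R 0 ∧ ∀ᶠ t in 𝓝 0, b t = t * R t := by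
  have hb' : SmoothNear (fun q : ℝ × ℝ => b q.2) (0, 0) :=
    SmoothNear.comp (F := fun q : ℝ × ℝ => q.2) hb (smoothNear_snd _)
  obtain ⟨G, hG, h⟩ := hb'.exists_eq_add_snd_mul
  refine ⟨fun t => G (0, t), SmoothNear.comp (F := fun t : ℝ => ((0 : ℝ), t)) hG
    ((smoothNear_const _ _).prodMk (smoothNear_id _)), ?_⟩
  have ht : Tendsto (fun t : ℝ => ((0 : ℝ), t)) (𝓝 0) (𝓝 (0, 0)) :=
    Continuous.tendsto' (by fun_prop) _ _ rfl
  filter_upwards [ht.eventually h] with t h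
  simpa [h0] using h

/-- One derivative turns `t^(m+1) R` into `t^m ((m+1) R + t R')`, which has the same shape, with the
new factor equal to `(m+1) R(0)` at `0`. -/
theorem iteratedDeriv_pow_mul_zero (m : ℕ) {R : ℝ → ℝ} (hR : SmoothNear R 0) :
    iteratedDeriv m (fun t => t ^ m * R t) 0 = m.factorial * R 0 := by
  induction m generalizing R with
  | zero => simp
  | succ m ih =>
    have h : deriv (fun t => t ^ (m + 1) * R t) =ᶠ[𝓝 0]
        fun t => t ^ m * ((m + 1) * R t + t * deriv R t) := by
      filter_upwards [hR.eventually_smoothNear] with t ht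
      have := (hasDerivAt_pow (m + 1) t).mul ht.differentiableAt.hasDerivAt
      refine HasDerivAt.deriv this |>.trans ?_
      push_cast
      ring
    rw [iteratedDeriv_succ', h.iteratedDeriv_eq, ih]
    · push_cast [Nat.factorial_succ]
      simp
      ring
    · exact ((smoothNear_const _ _).mul hR).add ((smoothNear_id _).mul hR.deriv)

/-- Taylor's formula at the order of vanishing: a smooth germ of order `≥ m` is `t ^ m * R t`. -/
theorem SmoothNear.exists_eq_pow_mul {b : ℝ → ℝ} (hb : SmoothNear b 0) (m : ℕ)
    (h0 : ∀ i < m, iteratedDeriv i b 0 = 0) :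
    ∃ R : ℝ → ℝ, SmoothNear R 0 ∧ (∀ᶠ t in 𝓝 0, b t = t ^ m * R t) ∧
      iteratedDeriv m b 0 = m.factorial * R 0 := by
  induction m with
  | zero => exact ⟨b, hb, by simp, by simp⟩
  | succ m ih =>
    obtain ⟨R, hR, hbR, hd⟩ := ih fun i hi => h0 i (by omega)
    have hR0 : R 0 = 0 := by
      have := h0 m (by omega)
      rw [hd] at this
      simpa [Nat.factorial_ne_zero] using this
    obtain ⟨T, hT, hRT⟩ := hR.exists_eq_mul_of_apply_zero hR0
    have hbT : ∀ᶠ t in 𝓝 0, b t = t ^ (m + 1) * T t := by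
      filter_upwards [hbR, hRT] with t h1 h2
      rw [h1, h2]; ring
    exact ⟨T, hT, hbT, by
      rw [Filter.EventuallyEq.iteratedDeriv_eq _ hbT, iteratedDeriv_pow_mul_zero _ hT]⟩

theorem SmoothNear.isBigO_of_pow {b : ℝ → ℝ} (hb : SmoothNear b 0) (m : ℕ)
    (h0 : ∀ i < m, iteratedDeriv i b 0 = 0) : b =O[𝓝 0] fun t => t ^ m := by
  obtain ⟨R, hR, hbR, -⟩ := hb.exists_eq_pow_mul m h0
  have := (Asymptotics.isBigO_refl (fun t : ℝ => t ^ m) (𝓝 0)).mul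
    (hR.continuousAt.isBigO_one ℝ)
  simp only [mul_one] at this
  exact this.congr' (by filter_upwards [hbR] with t ht; exact ht.symm) .rfl

/-! ### The inverse function theorem for smooth germs. -/

section LocalDiffeomorphisms

theorem SmoothNear.isLocalDiffeomorphAt {V : Type*} [NormedAddCommGroup V] [NormedSpace ℝ V]
    [FiniteDimensional ℝ V] {F : V → V} {q : V} (hF : SmoothNear F q)
    (hinj : Function.Injective (fderiv ℝ F q)) :
    IsLocalDiffeomorphAt 𝓘(ℝ, V) 𝓘(ℝ, V) ∞ F q := by
  have : CompleteSpace V := FiniteDimensional.complete ℝ V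
  let A : V ≃L[ℝ] V :=
    (LinearEquiv.ofInjectiveEndo (fderiv ℝ F q : V →ₗ[ℝ] V) hinj).toContinuousLinearEquiv
  have hA : (A : V →L[ℝ] V) = fderiv ℝ F q := by ext x; rfl
  have hAF : HasFDerivAt F (A : V →L[ℝ] V) q := hA ▸ hF.differentiableAt.hasFDerivAt
  let e := hF.contDiffAt.toOpenPartialHomeomorph F hAF (by simp)
  -- The domain is shrunk to where the differential stays invertible, so that the inverse is smooth
  -- on the whole target and not only at the image of `q`.
  have hT : ∀ᶠ x in 𝓝 q, ContDiffAt ℝ ∞ F x ∧ ∃ B : V ≃L[ℝ] V, (B : V →L[ℝ] V) = fderiv ℝ F x := by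
    have hB : Set.range ((↑) : (V ≃L[ℝ] V) → V →L[ℝ] V) ∈ 𝓝 (fderiv ℝ F q) :=
      hA ▸ ContinuousLinearEquiv.nhds A
    exact hF.and (hF.fderiv.continuousAt.tendsto hB)
  obtain ⟨U, hU, hUo, hqU⟩ := eventually_nhds_iff.1 hT
  let e' := e.restrOpen U hUo
  refine ⟨{ toPartialEquiv := e'.toPartialEquiv
            open_source := e'.open_source
            open_target := e'.open_target
            contMDiffOn_toFun := ?_
            contMDiffOn_invFun := ?_ },
    ⟨ContDiffAt.mem_toOpenPartialHomeomorph_source _ _ _, hqU⟩, fun x _ => rfl⟩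
  · intro x hx
    exact (hU x hx.2).1.contMDiffAt.contMDiffWithinAt
  · intro y hy
    have hy' : e'.symm y ∈ U := (e'.map_target hy).2
    obtain ⟨h1, B, hB⟩ := hU _ hy'
    exact (e'.contDiffAt_symm hy (f₀' := B)
      (hB ▸ (h1.differentiableAt (by simp)).hasFDerivAt) h1).contMDiffAt.contMDiffWithinAt

variable {V W : Type*} [NormedAddCommGroup V] [NormedSpace ℝ V] [NormedAddCommGroup W]
  [NormedSpace ℝ W]

theorem IsLocalDiffeomorphAt.smoothNear {F : V → W} {q : V}
    (h : IsLocalDiffeomorphAt 𝓘(ℝ, V) 𝓘(ℝ, W) ∞ F q) : SmoothNear F q := by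
  obtain ⟨Φ, hq, hΦ⟩ := h
  filter_upwards [Φ.open_source.mem_nhds hq] with x hx
  exact IsLocalDiffeomorphAt.contMDiffAt ⟨Φ, hx, hΦ⟩ |>.contDiffAt

/-- A local diffeomorphism has a local inverse which is a local diffeomorphism. -/
theorem IsLocalDiffeomorphAt.exists_inverse {F : V → W} {q : V}
    (h : IsLocalDiffeomorphAt 𝓘(ℝ, V) 𝓘(ℝ, W) ∞ F q) :
    ∃ G : W → V, G (F q) = q ∧ IsLocalDiffeomorphAt 𝓘(ℝ, W) 𝓘(ℝ, V) ∞ G (F q) ∧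
      (∀ᶠ x in 𝓝 q, G (F x) = x) ∧ ∀ᶠ y in 𝓝 (F q), F (G y) = y :=
  ⟨h.localInverse, h.localInverse_left_inv h.localInverse_mem_target,
    h.localInverse_isLocalDiffeomorphAt, h.localInverse_eventuallyEq_left,
    h.localInverse_eventuallyEq_right⟩

theorem isLocalDiffeomorphAt_id (q : V) :
    IsLocalDiffeomorphAt 𝓘(ℝ, V) 𝓘(ℝ, V) ∞ (fun x => x) q :=
  (Diffeomorph.refl 𝓘(ℝ, V) V ∞).isLocalDiffeomorph q

end LocalDiffeomorphisms

/-! ### `𝒜`-equivalence, and an invariant separating the types `A_k`. -/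

section AEquivalence

variable {h₁ h₂ h₃ : ℝ × ℝ → ℝ} {p q r : ℝ × ℝ}

theorem AEquivalentAt.symm (h : AEquivalentAt h₁ p h₂ q) (hc : ContinuousAt h₂ q) :
    AEquivalentAt h₂ q h₁ p := by
  obtain ⟨η, ξ, rfl, hη, hξ, heq⟩ := h
  obtain ⟨ζ, hζ0, hζ, -, hζη⟩ := hη.exists_inverse
  obtain ⟨τ, hτ0, hτ, hτξ, -⟩ := hξ.exists_inverse
  have hp : h₁ p = ξ (h₂ (η p)) := heq.self_of_nhds
  refine ⟨ζ, τ, hζ0, hζ, hp ▸ hτ, ?_⟩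
  have ht : Tendsto ζ (𝓝 (η p)) (𝓝 p) := by
    simpa only [hζ0] using hζ.smoothNear.continuousAt.tendsto
  filter_upwards [hζη, ht.eventually heq, hc.eventually hτξ] with y h1 h2 h3
  rw [h2, h1, h3]

theorem AEquivalentAt.trans (h : AEquivalentAt h₁ p h₂ q) (h' : AEquivalentAt h₂ q h₃ r) :
    AEquivalentAt h₁ p h₃ r := by
  obtain ⟨η, ξ, rfl, hη, hξ, heq⟩ := h
  obtain ⟨η', ξ', rfl, hη', hξ', heq'⟩ := h'
  refine ⟨η' ∘ η, ξ ∘ ξ', rfl, hη.comp _ _ hη', ?_, ?_⟩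
  · exact hξ'.comp _ _ (heq'.self_of_nhds ▸ hξ)
  · filter_upwards [heq, hη.smoothNear.continuousAt.eventually heq'] with x h1 h2
    rw [h1, h2]; rfl

theorem HasASingularity.congr {k : ℕ} (h : HasASingularity k h₂ q)
    (h' : AEquivalentAt h₁ p h₂ q) : HasASingularity k h₁ p := by
  obtain ⟨ε₁, ε₂, h1, h2, h3⟩ := h
  exact ⟨ε₁, ε₂, h1, h2, h'.trans h3⟩

/-- The differential of `h` is of order `k` at points arbitrarily close to `p`. For an
`A_k`-singularity, `k` is the largest order for which this happens. -/
def HasSmallDifferential (k : ℕ) (h : ℝ × ℝ → ℝ) (p : ℝ × ℝ) : Prop :=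
  ∃ C : ℝ, ∃ᶠ x in 𝓝[≠] p, ‖fderiv ℝ h x‖ ≤ C * ‖x - p‖ ^ k

/-- By the chain rule `‖dh₁‖` at `x` is at most a constant times `‖dh₂‖` at `η x`, while `‖η x - η
p‖` is at most a constant times `‖x - p‖`; nearby points with small `dh₂` are pulled back by the
local inverse of `η`. -/
theorem HasSmallDifferential.of_aEquivalentAt {k : ℕ} (h : AEquivalentAt h₁ p h₂ q)
    (hs : SmoothNear h₂ q) (hd : HasSmallDifferential k h₂ q) : HasSmallDifferential k h₁ p := by
  obtain ⟨η, ξ, rfl, hη, hξ, heq⟩ := h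
  obtain ⟨ζ, hζ0, hζ, -, hζη⟩ := hη.exists_inverse
  obtain ⟨C, hC⟩ := hd
  have ht : Tendsto ζ (𝓝 (η p)) (𝓝 p) := by
    simpa only [hζ0] using hζ.smoothNear.continuousAt.tendsto
  obtain ⟨L, hL⟩ := hη.smoothNear.differentiableAt.hasFDerivAt.isBigO_sub.bound
  have hξη : Tendsto (fun x => h₂ (η x)) (𝓝 p) (𝓝 (h₂ (η p))) :=
    hs.continuousAt.tendsto.comp hη.smoothNear.continuousAt
  have hM : ∃ M, ∀ᶠ x in 𝓝 p, ‖fderiv ℝ ξ (h₂ (η x))‖ * ‖fderiv ℝ η x‖ < M :=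
    ⟨_, (((hξ.smoothNear.fderiv.continuousAt.tendsto.comp hξη).norm.mul
      hη.smoothNear.fderiv.continuousAt.norm).eventually_lt_const (lt_add_one _))⟩
  obtain ⟨M, hM⟩ := hM
  have hM0 : 0 ≤ M := le_trans (by positivity) hM.self_of_nhds.le
  have hbound : ∀ᶠ x in 𝓝 p, ‖fderiv ℝ h₁ x‖ ≤ M * ‖fderiv ℝ h₂ (η x)‖ := by
    filter_upwards [hM, eventually_eventually_nhds.2 heq, hη.smoothNear.eventually_smoothNear,
      hη.smoothNear.continuousAt.eventually hs.eventually_smoothNear,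
      hξη.eventually hξ.smoothNear.eventually_smoothNear] with x h1 h2 h3 h4 h5
    have h6 : HasFDerivAt h₁ (((fderiv ℝ ξ (h₂ (η x))).comp (fderiv ℝ h₂ (η x))).comp
        (fderiv ℝ η x)) x :=
      ((h5.differentiableAt.hasFDerivAt.comp (η x) h4.differentiableAt.hasFDerivAt).comp x
        h3.differentiableAt.hasFDerivAt).congr_of_eventuallyEq h2
    rw [h6.fderiv]
    calc _ ≤ (‖fderiv ℝ ξ (h₂ (η x))‖ * ‖fderiv ℝ h₂ (η x)‖) * ‖fderiv ℝ η x‖ :=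
          (ContinuousLinearMap.opNorm_comp_le _ _).trans (by
            gcongr; exact ContinuousLinearMap.opNorm_comp_le _ _)
      _ = (‖fderiv ℝ ξ (h₂ (η x))‖ * ‖fderiv ℝ η x‖) * ‖fderiv ℝ h₂ (η x)‖ := by ring
      _ ≤ _ := by gcongr
  -- The pulled-back points must stay different from `p`, which follows from `η ∘ ζ = id`.
  have ht' : Tendsto ζ (𝓝[≠] (η p)) (𝓝[≠] p) := by
    refine tendsto_nhdsWithin_iff.2 ⟨ht.mono_left nhdsWithin_le_nhds, ?_⟩
    filter_upwards [self_mem_nhdsWithin, nhdsWithin_le_nhds hζη] with y hy hy' h0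
    rw [Set.mem_singleton_iff.1 h0] at hy'
    exact hy hy'.symm
  refine ⟨M * (|C| * |L| ^ k), ht'.frequently ?_⟩
  refine (hC.and_eventually (nhdsWithin_le_nhds
    (hζη.and ((ht.eventually hbound).and (ht.eventually hL))))).mono ?_
  rintro y ⟨h1, h2, h3, h4⟩
  rw [h2] at h3 h4
  have h5 : ‖y - η p‖ ≤ |L| * ‖ζ y - p‖ := h4.trans (by gcongr; exact le_abs_self L)
  calc _ ≤ M * ‖fderiv ℝ h₂ y‖ := h3
    _ ≤ M * (|C| * (|L| * ‖ζ y - p‖) ^ k) := by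
        gcongr
        refine h1.trans ?_
        gcongr
        exact le_abs_self C
    _ = _ := by ring

theorem hasFDerivAt_normalForm (k : ℕ) (ε₁ ε₂ : ℝ) (x : ℝ × ℝ) :
    HasFDerivAt (fun x : ℝ × ℝ => ε₁ * x.1 ^ (k + 1) + ε₂ * x.2 ^ 2)
      ((ε₁ * ((k + 1) * x.1 ^ k)) • ContinuousLinearMap.fst ℝ ℝ ℝ +
        (ε₂ * (2 * x.2)) • ContinuousLinearMap.snd ℝ ℝ ℝ) x := by
  have h1 := ((hasFDerivAt_fst (𝕜 := ℝ) (p := x)).pow (k + 1)).const_mul ε₁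
  have h2 := ((hasFDerivAt_snd (𝕜 := ℝ) (p := x)).pow 2).const_mul ε₂
  refine (h1.add h2).congr_fderiv ?_
  ext <;> simp

theorem smoothNear_normalForm (k : ℕ) (ε₁ ε₂ : ℝ) (q : ℝ × ℝ) :
    SmoothNear (fun x : ℝ × ℝ => ε₁ * x.1 ^ (k + 1) + ε₂ * x.2 ^ 2) q :=
  ContDiff.smoothNear (by fun_prop) q

theorem frequently_punctured_of_curve {γ : ℝ → ℝ × ℝ} (hγ : ContinuousAt γ 0) (h0 : γ 0 = p)
    (hne : ∀ t ≠ 0, γ t ≠ p) {P : ℝ × ℝ → Prop} (hP : ∀ᶠ t in 𝓝 0, P (γ t)) :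
    ∃ᶠ x in 𝓝[≠] p, P x := by
  have ht : Tendsto γ (𝓝[≠] 0) (𝓝[≠] p) := by
    refine tendsto_nhdsWithin_iff.2 ⟨?_, ?_⟩
    · exact (h0 ▸ hγ.tendsto).mono_left nhdsWithin_le_nhds
    · filter_upwards [self_mem_nhdsWithin] with t h using hne t h
  exact ht.frequently (Eventually.frequently (nhdsWithin_le_nhds hP))

/-- On the `x₁`-axis the differential is `± (k+1) x₁^k dx₁` when `ε₁ = ± 1`. -/
theorem hasSmallDifferential_normalForm (k : ℕ) (ε₁ ε₂ : ℝ) :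
    HasSmallDifferential k (fun x : ℝ × ℝ => ε₁ * x.1 ^ (k + 1) + ε₂ * x.2 ^ 2) (0, 0) := by
  refine ⟨|ε₁| * (k + 1), frequently_punctured_of_curve (γ := fun t => (t, 0)) (by fun_prop) rfl
    (fun t ht h => ht (Prod.mk.inj h).1) (.of_forall fun t => ?_)⟩
  rw [(hasFDerivAt_normalForm k ε₁ ε₂ (t, 0)).fderiv]
  refine ContinuousLinearMap.opNorm_le_bound _ (by positivity) fun y => ?_
  have : |(k + 1 : ℝ)| = k + 1 := abs_of_nonneg (by positivity)
  simp [Prod.norm_def, this]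
  rw [← mul_assoc |ε₁|]
  exact mul_le_mul_of_nonneg_left (le_max_left |y.1| |y.2|) (by positivity)

theorem not_hasSmallDifferential_normalForm {k : ℕ} (hk : 1 ≤ k) {ε₁ ε₂ : ℝ}
    (h₁ : ε₁ = 1 ∨ ε₁ = -1) (h₂ : ε₂ = 1 ∨ ε₂ = -1) :
    ¬ HasSmallDifferential (k + 1) (fun x : ℝ × ℝ => ε₁ * x.1 ^ (k + 1) + ε₂ * x.2 ^ 2)
      (0, 0) := by
  rintro ⟨C, hC⟩
  have hn : Tendsto (fun x : ℝ × ℝ => ‖x‖) (𝓝 (0, 0)) (𝓝 0) := by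
    simpa using (continuous_norm.tendsto ((0, 0) : ℝ × ℝ))
  have hCn : Tendsto (fun x : ℝ × ℝ => C * ‖x‖) (𝓝 (0, 0)) (𝓝 0) := by
    simpa using hn.const_mul C
  -- Where `C ‖x‖ < 1`, a bound `C ‖x‖^(k+1)` falls below `‖x‖^k`. Both partial derivatives are then
  -- smaller than `‖x‖^k`.
  have hsmall : ∀ᶠ x : ℝ × ℝ in 𝓝[≠] (0, 0), ‖x‖ < 1 ∧ C * ‖x‖ < 1 ∧ x ≠ (0, 0) := by
    filter_upwards [nhdsWithin_le_nhds (hn.eventually_lt_const one_pos),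
      nhdsWithin_le_nhds (hCn.eventually_lt_const one_pos), self_mem_nhdsWithin] with x h h' h''
    exact ⟨h, h', h''⟩
  obtain ⟨x, hx, hx1, hx2, hx0⟩ := (hC.and_eventually hsmall).exists
  have hr : 0 < ‖x‖ := norm_pos_iff.2 hx0
  rw [(hasFDerivAt_normalForm k ε₁ ε₂ x).fderiv] at hx
  have habs : ∀ {ε : ℝ}, (ε = 1 ∨ ε = -1) → |ε| = 1 := by rintro ε (rfl | rfl) <;> simp
  have hlt : C * ‖x - (0, 0)‖ ^ (k + 1) < ‖x‖ ^ k := by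
    have : x - (0, 0) = x := sub_zero x
    rw [this, pow_succ', ← mul_assoc]
    exact mul_lt_of_lt_one_left (by positivity) hx2
  have e1 : (k + 1 : ℝ) * |x.1| ^ k < ‖x‖ ^ k := by
    have h' := (ContinuousLinearMap.le_opNorm ((ε₁ * ((k + 1) * x.1 ^ k)) •
      ContinuousLinearMap.fst ℝ ℝ ℝ + (ε₂ * (2 * x.2)) • ContinuousLinearMap.snd ℝ ℝ ℝ)
      ((1 : ℝ), (0 : ℝ)))
    have : |(k + 1 : ℝ)| = k + 1 := abs_of_nonneg (by positivity)
    simp [habs h₁, Prod.norm_def, this] at h'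
    simp only [Prod.norm_def, Real.norm_eq_abs] at hx hlt ⊢
    exact h'.trans_lt (hx.trans_lt hlt)
  have e2 : 2 * |x.2| < ‖x‖ ^ k := by
    have h' := (ContinuousLinearMap.le_opNorm ((ε₁ * ((k + 1) * x.1 ^ k)) •
      ContinuousLinearMap.fst ℝ ℝ ℝ + (ε₂ * (2 * x.2)) • ContinuousLinearMap.snd ℝ ℝ ℝ)
      ((0 : ℝ), (1 : ℝ)))
    simp [habs h₂, Prod.norm_def] at h'
    simp only [Prod.norm_def, Real.norm_eq_abs] at hx hlt ⊢
    exact h'.trans_lt (hx.trans_lt hlt)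
  -- The norm is the sup norm. If `|x₁|` attains it, `(k+1)|x₁|^k < |x₁|^k` is absurd; if `|x₂|`
  -- does, `2|x₂| < |x₂|^k ≤ |x₂|` is, the last inequality using `k ≥ 1`.
  rcases max_choice |x.1| |x.2| with h | h
  · have h3 : ‖x‖ = |x.1| := h
    rw [h3] at e1 hr
    have : 0 < |x.1| ^ k := by positivity
    nlinarith [(Nat.cast_nonneg k : (0 : ℝ) ≤ k)]
  · have h3 : ‖x‖ = |x.2| := h
    have : ‖x‖ ^ k ≤ ‖x‖ ^ 1 := pow_le_pow_of_le_one hr.le hx1.le hk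
    rw [pow_one] at this
    linarith

theorem HasASingularity.hasSmallDifferential {k : ℕ} (h : HasASingularity k h₁ p) :
    HasSmallDifferential k h₁ p := by
  obtain ⟨ε₁, ε₂, -, -, h'⟩ := h
  exact .of_aEquivalentAt h' (smoothNear_normalForm ..) (hasSmallDifferential_normalForm ..)

theorem HasASingularity.not_hasSmallDifferential {k : ℕ} (hk : 1 ≤ k)
    (h : HasASingularity k h₁ p) (hs : SmoothNear h₁ p) :
    ¬ HasSmallDifferential (k + 1) h₁ p := by
  obtain ⟨ε₁, ε₂, h1, h2, h'⟩ := h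
  exact fun hd => not_hasSmallDifferential_normalForm hk h1 h2
    (.of_aEquivalentAt (h'.symm (smoothNear_normalForm ..).continuousAt) hs hd)

end AEquivalence

/-! ### Splitting along a critical curve and reduction to normal form. -/

section NormalForm

theorem exists_sign_mul_pos {s : ℝ} (hs : s ≠ 0) : ∃ ε : ℝ, (ε = 1 ∨ ε = -1) ∧ 0 < ε * s := by
  rcases lt_or_gt_of_ne hs with h | h
  · exact ⟨-1, .inr rfl, by linarith⟩
  · exact ⟨1, .inl rfl, by linarith⟩

theorem SmoothNear.comp_fst {b : ℝ → ℝ} {q : ℝ × ℝ} (hb : SmoothNear b q.1) :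
    SmoothNear (fun q : ℝ × ℝ => b q.1) q :=
  SmoothNear.comp (F := fun q : ℝ × ℝ => q.1) hb (smoothNear_fst q)

theorem eventually_fst {P : ℝ → Prop} (h : ∀ᶠ u in 𝓝 0, P u) :
    ∀ᶠ q in 𝓝 ((0, 0) : ℝ × ℝ), P q.1 :=
  (continuous_fst.tendsto ((0, 0) : ℝ × ℝ)).eventually h

theorem tendsto_graph {β : ℝ → ℝ} (hβ : SmoothNear β 0) (hβ0 : β 0 = 0) :
    Tendsto (fun u => (u, β u)) (𝓝 0) (𝓝 (0, 0)) := by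
  have h : ContinuousAt (fun u => (u, β u)) 0 := continuousAt_id.prodMk hβ.continuousAt
  simpa only [ContinuousAt, hβ0] using h

/-- With signs extracted, the new coordinates are `u |S|^(1/(k+1))` and `(v - β) |Q|^(1/2)`; their
differential at the origin is triangular with nonzero diagonal. -/
theorem hasASingularity_of_eventuallyEq {h Q : ℝ × ℝ → ℝ} {β S : ℝ → ℝ} {k : ℕ}
    (hβ : SmoothNear β 0) (hS : SmoothNear S 0) (hS0 : S 0 ≠ 0)
    (hβS : ∀ᶠ u in 𝓝 0, β u = u ^ (k + 1) * S u)
    (hQ : SmoothNear Q (0, 0)) (hQ0 : Q (0, 0) ≠ 0)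
    (hh : ∀ᶠ q in 𝓝 ((0, 0) : ℝ × ℝ), h q = β q.1 + (q.2 - β q.1) ^ 2 * Q q) :
    HasASingularity k h (0, 0) := by
  obtain ⟨ε₁, hε₁, hS1⟩ := exists_sign_mul_pos hS0
  obtain ⟨ε₂, hε₂, hQ1⟩ := exists_sign_mul_pos hQ0
  let a : ℝ → ℝ := fun u => (ε₁ * S u) ^ ((k + 1 : ℕ) : ℝ)⁻¹
  let c : ℝ × ℝ → ℝ := fun q => √(ε₂ * Q q)
  have ha : SmoothNear a 0 := ((smoothNear_const ε₁ _).mul hS).rpow_const hS1.ne' _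
  have hc : SmoothNear c (0, 0) := ((smoothNear_const ε₂ _).mul hQ).sqrt hQ1.ne'
  have ha0 : a 0 ≠ 0 := (Real.rpow_pos_of_pos hS1 _).ne'
  have hc0 : c (0, 0) ≠ 0 := (Real.sqrt_pos.2 hQ1).ne'
  have hβ0 : β 0 = 0 := by simpa using hβS.self_of_nhds
  let η : ℝ × ℝ → ℝ × ℝ := fun q => (q.1 * a q.1, (q.2 - β q.1) * c q)
  have hη : SmoothNear η (0, 0) := by
    refine ((smoothNear_fst _).mul (SmoothNear.comp_fst ha)).prodMk (.mul ?_ hc)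
    exact (smoothNear_snd _).sub (SmoothNear.comp_fst hβ)
  have hηd : HasFDerivAt η ((a 0 • ContinuousLinearMap.fst ℝ ℝ ℝ).prod
      (c (0, 0) • (ContinuousLinearMap.snd ℝ ℝ ℝ - fderiv ℝ (fun q : ℝ × ℝ => β q.1) (0, 0))))
      (0, 0) := by
    refine HasFDerivAt.prodMk ?_ ?_
    · refine ((hasFDerivAt_fst (𝕜 := ℝ) (p := ((0 : ℝ), (0 : ℝ)))).mul
        (SmoothNear.comp_fst (q := (0, 0)) ha).differentiableAt.hasFDerivAt).congr_fderiv ?_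
      simp
    · refine (((hasFDerivAt_snd (𝕜 := ℝ) (p := ((0 : ℝ), (0 : ℝ)))).sub
        (SmoothNear.comp_fst (q := (0, 0)) hβ).differentiableAt.hasFDerivAt).mul
          hc.differentiableAt.hasFDerivAt).congr_fderiv ?_
      simp [hβ0]
  have hfd : fderiv ℝ (fun q : ℝ × ℝ => β q.1) (0, 0) =
      (fderiv ℝ β 0).comp (ContinuousLinearMap.fst ℝ ℝ ℝ) :=
    (HasFDerivAt.comp (f := fun q : ℝ × ℝ => q.1) ((0, 0) : ℝ × ℝ)
      hβ.differentiableAt.hasFDerivAt hasFDerivAt_fst).fderiv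
  refine ⟨ε₁, ε₂, hε₁, hε₂, η, fun x => x, ?_, hη.isLocalDiffeomorphAt ?_,
    isLocalDiffeomorphAt_id _, ?_⟩
  · simp [η, hβ0]
  · rw [hηd.fderiv, injective_iff_map_eq_zero, hfd]
    rintro ⟨x, y⟩ hxy
    simp [ha0, hc0] at hxy
    obtain ⟨rfl, h2⟩ := hxy
    simp at h2
    simp [h2]
  · have hS1' : ∀ᶠ u in 𝓝 0, 0 < ε₁ * S u :=
      ((smoothNear_const ε₁ _).mul hS).continuousAt.eventually (lt_mem_nhds hS1)
    have hQ1' : ∀ᶠ q in 𝓝 ((0, 0) : ℝ × ℝ), 0 < ε₂ * Q q :=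
      ((smoothNear_const ε₂ _).mul hQ).continuousAt.eventually (lt_mem_nhds hQ1)
    filter_upwards [hh, eventually_fst hβS, eventually_fst hS1', hQ1'] with q h1 h2 h3 h4
    have e1 : a q.1 ^ (k + 1) = ε₁ * S q.1 := Real.rpow_inv_natCast_pow h3.le (by simp)
    have e2 : c q ^ 2 = ε₂ * Q q := Real.sq_sqrt h4.le
    have s1 : ε₁ * ε₁ = 1 := by rcases hε₁ with rfl | rfl <;> norm_num
    have s2 : ε₂ * ε₂ = 1 := by rcases hε₂ with rfl | rfl <;> norm_num
    have : β q.1 = q.1 ^ (k + 1) * S q.1 := h2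
    simp only [η, mul_pow, e1, e2]
    rw [h1]
    linear_combination this - q.1 ^ (k + 1) * S q.1 * s1 - (q.2 - β q.1) ^ 2 * Q q * s2

/-- On the graph `v = β(u)` the squared term contributes nothing to the differential, which reduces
to `β'(u) du`, of order `k`. No nonvanishing of `S` or `Q` is needed. -/
theorem hasSmallDifferential_of_eventuallyEq {h Q : ℝ × ℝ → ℝ} {β S : ℝ → ℝ} {k : ℕ}
    (hβ : SmoothNear β 0) (hS : SmoothNear S 0)
    (hβS : ∀ᶠ u in 𝓝 0, β u = u ^ (k + 1) * S u) (hQ : SmoothNear Q (0, 0))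
    (hh : ∀ᶠ q in 𝓝 ((0, 0) : ℝ × ℝ), h q = β q.1 + (q.2 - β q.1) ^ 2 * Q q) :
    HasSmallDifferential k h (0, 0) := by
  have hβ0 : β 0 = 0 := by simpa using hβS.self_of_nhds
  have hγ : Tendsto (fun u => (u, β u)) (𝓝 0) (𝓝 (0, 0)) :=
    tendsto_graph hβ hβ0
  have hT : SmoothNear (fun u => (k + 1) * S u + u * deriv S u) 0 :=
    ((smoothNear_const _ _).mul hS).add ((smoothNear_id _).mul hS.deriv)
  obtain ⟨C, hC⟩ := (hT.continuousAt.isBigO_one ℝ).bound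
  refine ⟨C, frequently_punctured_of_curve (γ := fun u => (u, β u))
    (continuousAt_id.prodMk hβ.continuousAt) (by rw [hβ0])
    (fun t ht h => ht (Prod.mk.inj h).1) ?_⟩
  filter_upwards [hC, eventually_eventually_nhds.2 hβS, hS.eventually_smoothNear,
    hγ.eventually (eventually_eventually_nhds.2 hh),
    hγ.eventually hQ.eventually_smoothNear] with u h1 h2 h3 h4 h5
  have hβd : HasDerivAt β (u ^ k * ((k + 1) * S u + u * deriv S u)) u := by
    refine (((hasDerivAt_pow (k + 1) u).mul
      h3.differentiableAt.hasDerivAt).congr_of_eventuallyEq h2).congr_deriv ?_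
    push_cast
    ring
  have hβf : HasFDerivAt (fun q : ℝ × ℝ => β q.1)
      ((u ^ k * ((k + 1) * S u + u * deriv S u)) • ContinuousLinearMap.fst ℝ ℝ ℝ) (u, β u) :=
    HasDerivAt.comp_hasFDerivAt (f := fun q : ℝ × ℝ => q.1) (u, β u) hβd hasFDerivAt_fst
  have hd := (hβf.add ((((hasFDerivAt_snd (𝕜 := ℝ) (p := (u, β u))).sub hβf).pow 2).mul
    h5.differentiableAt.hasFDerivAt)).congr_of_eventuallyEq h4
  rw [hd.fderiv]
  simp only [Pi.sub_apply, sub_self, ne_eq, OfNat.ofNat_ne_zero, not_false_eq_true,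
    zero_pow, zero_smul, Nat.add_one_sub_one, pow_one, smul_zero, add_zero]
  rw [norm_smul, norm_mul, norm_pow, mul_comm, mul_comm C, ← mul_assoc]
  have e1 : ‖ContinuousLinearMap.fst ℝ ℝ ℝ‖ ≤ 1 := ContinuousLinearMap.norm_fst_le _ _ _
  have e2 : ‖u‖ ≤ ‖(u, β u) - (0, 0)‖ := by
    simp [Prod.norm_def]
  simp only [norm_one, mul_one] at h1
  have : 0 ≤ C := (norm_nonneg _).trans h1
  calc _ ≤ 1 * ‖u‖ ^ k * C := by gcongr
    _ ≤ _ := by rw [one_mul]; gcongr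

/-- Splitting lemma along a curve of critical points in the second variable. -/
theorem SmoothNear.exists_eq_add_sq_mul {h : ℝ × ℝ → ℝ} {β : ℝ → ℝ} (hh : SmoothNear h (0, 0))
    (hβ : SmoothNear β 0) (hβ0 : β 0 = 0) (hcrit : ∀ᶠ u in 𝓝 0, dv h (u, β u) = 0) :
    ∃ Q : ℝ × ℝ → ℝ, SmoothNear Q (0, 0) ∧
      (∀ᶠ q in 𝓝 ((0, 0) : ℝ × ℝ), h q = h (q.1, β q.1) + (q.2 - β q.1) ^ 2 * Q q) ∧
      iteratedDeriv 2 (fun v => h (0, v)) 0 = 2 * Q (0, 0) := by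
  have hβ' : SmoothNear (fun q : ℝ × ℝ => β q.1) (0, 0) := SmoothNear.comp_fst (q := (0, 0)) hβ
  -- Straightening the curve to `v = 0` lets Hadamard's lemma be applied twice.
  have hF : SmoothNear (fun q : ℝ × ℝ => h (q.1, q.2 + β q.1)) (0, 0) :=
    SmoothNear.comp (F := fun q : ℝ × ℝ => (q.1, q.2 + β q.1)) (by simpa [hβ0] using hh)
      ((smoothNear_fst _).prodMk ((smoothNear_snd _).add hβ'))
  obtain ⟨F₁, hF₁, hFF₁⟩ := hF.exists_eq_add_snd_mul
  obtain ⟨F₂, hF₂, hFF₂⟩ := hF₁.exists_eq_add_snd_mul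
  have hι : Tendsto (fun u : ℝ => (u, (0 : ℝ))) (𝓝 0) (𝓝 (0, 0)) :=
    Continuous.tendsto' (by fun_prop) _ _ rfl
  have hγ : Tendsto (fun u => (u, β u)) (𝓝 0) (𝓝 (0, 0)) :=
    tendsto_graph hβ hβ0
  -- The first quotient on the axis is `∂h/∂v` on the curve, which vanishes; this permits the second
  -- division.
  have hF₁0 : ∀ᶠ u in 𝓝 0, F₁ (u, 0) = 0 := by
    filter_upwards [hcrit, hι.eventually (eventually_eventually_nhds.2 hFF₁),
      hι.eventually hF₁.eventually_smoothNear, hγ.eventually hh.eventually_smoothNear]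
      with u h1 h2 h3 h4
    have hv : Tendsto (fun v : ℝ => (u, v)) (𝓝 0) (𝓝 (u, 0)) :=
      Continuous.tendsto' (by fun_prop) _ _ rfl
    have d1 : HasDerivAt (fun v => h (u, v + β u)) (dv h (u, β u)) 0 := by
      have h4' : HasFDerivAt h (fderiv ℝ h (u, β u)) (u, 0 + β u) := by
        rw [zero_add]; exact h4.differentiableAt.hasFDerivAt
      exact h4'.comp_hasDerivAt (0 : ℝ)
        ((hasDerivAt_const (0 : ℝ) u).prodMk ((hasDerivAt_id (0 : ℝ)).add_const (β u)))
    have d2 : HasDerivAt (fun v => h (u, v + β u)) (F₁ (u, 0)) 0 := by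
      have h5 : DifferentiableAt ℝ (fun v => F₁ (u, v)) 0 :=
        DifferentiableAt.comp (f := fun v : ℝ => (u, v)) 0 h3.differentiableAt (by fun_prop)
      have := (((hasDerivAt_id (0 : ℝ)).mul h5.hasDerivAt).const_add
        (h (u, 0 + β u))).congr_of_eventuallyEq (hv.eventually h2)
      simpa using this
    rw [← d2.unique d1] at h1
    exact h1
  have hs : Tendsto (fun q : ℝ × ℝ => (q.1, q.2 - β q.1)) (𝓝 (0, 0)) (𝓝 (0, 0)) := by
    have := ((smoothNear_fst ((0, 0) : ℝ × ℝ)).prodMk ((smoothNear_snd _).sub hβ')).continuousAt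
    simpa [ContinuousAt, hβ0] using this
  have hQ : SmoothNear (fun q : ℝ × ℝ => F₂ (q.1, q.2 - β q.1)) (0, 0) :=
    SmoothNear.comp (F := fun q : ℝ × ℝ => (q.1, q.2 - β q.1)) (by simpa [hβ0] using hF₂)
      ((smoothNear_fst _).prodMk ((smoothNear_snd _).sub hβ'))
  have heq : ∀ᶠ q in 𝓝 ((0, 0) : ℝ × ℝ),
      h q = h (q.1, β q.1) + (q.2 - β q.1) ^ 2 * F₂ (q.1, q.2 - β q.1) := by
    filter_upwards [hs.eventually hFF₁, hs.eventually hFF₂, eventually_fst hF₁0] with q h1 h2 h3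
    simp only [sub_add_cancel, zero_add] at h1 h2
    rw [h3] at h2
    rw [h1, h2]
    ring
  refine ⟨_, hQ, heq, ?_⟩
  have hv : Tendsto (fun v : ℝ => ((0 : ℝ), v)) (𝓝 0) (𝓝 (0, 0)) :=
    Continuous.tendsto' (by fun_prop) _ _ rfl
  have hR : SmoothNear (fun v : ℝ => F₂ (0, v)) 0 :=
    SmoothNear.comp (F := fun v : ℝ => ((0 : ℝ), v)) hF₂
      ((smoothNear_const _ _).prodMk (smoothNear_id _))
  have h1 : (fun v => h (0, v)) =ᶠ[𝓝 0] fun v => h (0, 0) + v ^ 2 * F₂ (0, v) := by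
    filter_upwards [hv.eventually heq] with v h1
    simpa [hβ0] using h1
  rw [h1.iteratedDeriv_eq, iteratedDeriv_const_add (by norm_num), iteratedDeriv_pow_mul_zero 2 hR]
  simp [hβ0]

/-- Smooth implicit curves `v = β u`. -/
theorem SmoothNear.exists_implicit_curve {B : ℝ × ℝ → ℝ} (hB : SmoothNear B (0, 0))
    (hB0 : B (0, 0) = 0) (hBv : dv B (0, 0) ≠ 0) :
    ∃ β : ℝ → ℝ, SmoothNear β 0 ∧ β 0 = 0 ∧ ∀ᶠ u in 𝓝 0, B (u, β u) = 0 := by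
  -- The map `(u, v) ↦ (u, B(u, v))` is a local diffeomorphism, and its inverse restricted to the
  -- axis parametrizes the zero set of `B`.
  have hΘ : SmoothNear (fun q : ℝ × ℝ => (q.1, B q)) (0, 0) := (smoothNear_fst _).prodMk hB
  have hd : HasFDerivAt (fun q : ℝ × ℝ => (q.1, B q))
      ((ContinuousLinearMap.fst ℝ ℝ ℝ).prod (fderiv ℝ B (0, 0))) (0, 0) :=
    hasFDerivAt_fst.prodMk hB.differentiableAt.hasFDerivAt
  have hΘ' := hΘ.isLocalDiffeomorphAt (by
    rw [hd.fderiv, injective_iff_map_eq_zero]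
    rintro ⟨x, y⟩ hxy
    obtain ⟨rfl, h2⟩ : x = 0 ∧ fderiv ℝ B (0, 0) (x, y) = 0 := by simpa using hxy
    have : ((0 : ℝ), y) = y • ((0 : ℝ), (1 : ℝ)) := by simp
    rw [this, map_smul] at h2
    have : y = 0 := by simpa [show fderiv ℝ B (0, 0) (0, 1) ≠ 0 from hBv] using h2
    simp [this])
  obtain ⟨G, hG0, hG, -, hΘG⟩ := hΘ'.exists_inverse
  rw [hB0] at hG0 hG hΘG
  have hι : Tendsto (fun u : ℝ => (u, (0 : ℝ))) (𝓝 0) (𝓝 (0, 0)) :=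
    Continuous.tendsto' (by fun_prop) _ _ rfl
  refine ⟨fun u => (G (u, 0)).2, ?_, by simp [hG0], ?_⟩
  · exact SmoothNear.comp (F := fun u : ℝ => G (u, 0)) (smoothNear_snd _)
      (SmoothNear.comp (F := fun u : ℝ => (u, (0 : ℝ))) hG.smoothNear
        ((smoothNear_id _).prodMk (smoothNear_const _ _)))
  · filter_upwards [hι.eventually hΘG] with u hu
    have h1 : (G (u, 0)).1 = u := congrArg Prod.fst hu
    have h2 : B (G (u, 0)) = 0 := congrArg Prod.snd hu
    rwa [← Prod.mk.eta (p := G (u, 0)), h1] at h2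

theorem iteratedDeriv_fst_line {B : ℝ × ℝ → ℝ} (hB : SmoothNear B (0, 0)) (i : ℕ) :
    iteratedDeriv i (fun u => B (u, 0)) 0 = (du^[i] B) (0, 0) := by
  induction i generalizing B with
  | zero => simp
  | succ i ih =>
    have hι : Tendsto (fun u : ℝ => (u, (0 : ℝ))) (𝓝 0) (𝓝 (0, 0)) :=
      Continuous.tendsto' (by fun_prop) _ _ rfl
    have : deriv (fun u => B (u, 0)) =ᶠ[𝓝 0] fun u => du B (u, 0) := by
      filter_upwards [hι.eventually hB.eventually_smoothNear] with u hu
      exact (hu.differentiableAt.hasFDerivAt.comp_hasDerivAt u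
        ((hasDerivAt_id u).prodMk (hasDerivAt_const u (0 : ℝ)))).deriv
    rw [iteratedDeriv_succ', this.iteratedDeriv_eq, ih hB.du, Function.iterate_succ_apply]

/-- The order of contact of an implicit curve with the axis `v = 0`. -/
theorem implicit_curve_order {B : ℝ × ℝ → ℝ} {β : ℝ → ℝ} (hB : SmoothNear B (0, 0))
    (hBv : dv B (0, 0) ≠ 0) (hβ : SmoothNear β 0) (hβ0 : β 0 = 0)
    (hBβ : ∀ᶠ u in 𝓝 0, B (u, β u) = 0) {m : ℕ} (hm : ∀ i < m, (du^[i] B) (0, 0) = 0) :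
    ∃ S : ℝ → ℝ, SmoothNear S 0 ∧ (∀ᶠ u in 𝓝 0, β u = u ^ m * S u) ∧
      (S 0 = 0 → (du^[m] B) (0, 0) = 0) := by
  have hb : SmoothNear (fun u => B (u, 0)) 0 :=
    SmoothNear.comp (F := fun u : ℝ => (u, (0 : ℝ))) hB
      ((smoothNear_id _).prodMk (smoothNear_const _ _))
  obtain ⟨R, hR, hbR, hd⟩ := hb.exists_eq_pow_mul m fun i hi => by
    rw [iteratedDeriv_fst_line hB, hm i hi]
  obtain ⟨M, hM, hBM⟩ := hB.exists_eq_add_snd_mul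
  have hM0 : M (0, 0) = dv B (0, 0) := by
    have hv : Tendsto (fun v : ℝ => ((0 : ℝ), v)) (𝓝 0) (𝓝 (0, 0)) :=
      Continuous.tendsto' (by fun_prop) _ _ rfl
    have d1 : HasDerivAt (fun v => B (0, v)) (dv B (0, 0)) 0 :=
      hB.differentiableAt.hasFDerivAt.comp_hasDerivAt (0 : ℝ)
        ((hasDerivAt_const (0 : ℝ) (0 : ℝ)).prodMk (hasDerivAt_id (0 : ℝ)))
    have h5 : DifferentiableAt ℝ (fun v => M (0, v)) 0 :=
      DifferentiableAt.comp (f := fun v : ℝ => ((0 : ℝ), v)) 0 hM.differentiableAt (by fun_prop)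
    have d2 := (((hasDerivAt_id (0 : ℝ)).mul h5.hasDerivAt).const_add
      (B (0, 0))).congr_of_eventuallyEq (hv.eventually hBM)
    have := d2.unique d1
    simpa using this
  have hγ : Tendsto (fun u => (u, β u)) (𝓝 0) (𝓝 (0, 0)) :=
    tendsto_graph hβ hβ0
  have hMβ : SmoothNear (fun u => M (u, β u)) 0 :=
    SmoothNear.comp (F := fun u : ℝ => (u, β u)) (by simpa [hβ0] using hM)
      ((smoothNear_id _).prodMk hβ)
  have hMβ0 : M (0, β 0) ≠ 0 := by rwa [hβ0, hM0]
  -- Writing `B(u, v) = B(u, 0) + v M` and `B(u, 0) = u^m R`, the equation `B(u, β) = 0` becomes `β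
  -- = -u^m R / M`, and `M(0, 0) = B_v(0, 0) ≠ 0`.
  refine ⟨fun u => -R u / M (u, β u), hR.neg.div hMβ hMβ0, ?_, fun h0 => ?_⟩
  · filter_upwards [hBβ, hγ.eventually hBM, hbR, hMβ.continuousAt.eventually_ne hMβ0]
      with u h1 h2 h3 h4
    have h2' : B (u, β u) = B (u, 0) + β u * M (u, β u) := h2
    have h4' : M (u, β u) ≠ 0 := h4
    field_simp
    linear_combination h1 - h2' - h3
  · have hR0 : R 0 = 0 := by simpa [hMβ0] using h0
    rw [← iteratedDeriv_fst_line hB, hd, hR0, mul_zero]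

/-- If `h(u,v) = v` and `h_v(u,v) = 0` on the curve `B = 0`, and `h_vv ≠ 0`, then the order of
contact of this curve with the `u`-axis determines the singularity of `h`. -/
theorem singularity_of_implicit_curve {h B : ℝ × ℝ → ℝ} (hh : SmoothNear h (0, 0))
    (hB : SmoothNear B (0, 0)) (hB0 : B (0, 0) = 0) (hBv : dv B (0, 0) ≠ 0)
    (hcrit : ∀ᶠ q in 𝓝 ((0, 0) : ℝ × ℝ), B q = 0 → h q = q.2 ∧ dv h q = 0)
    (hnd : iteratedDeriv 2 (fun v => h (0, v)) 0 ≠ 0) {k : ℕ}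
    (hk : ∀ i < k + 1, (du^[i] B) (0, 0) = 0) :
    HasSmallDifferential k h (0, 0) ∧
      ((du^[k + 1] B) (0, 0) ≠ 0 → HasASingularity k h (0, 0)) := by
  obtain ⟨β, hβ, hβ0, hBβ⟩ := hB.exists_implicit_curve hB0 hBv
  have hγ : Tendsto (fun u => (u, β u)) (𝓝 0) (𝓝 (0, 0)) :=
    tendsto_graph hβ hβ0
  obtain ⟨Q, hQ, heq, hQd⟩ := hh.exists_eq_add_sq_mul hβ hβ0 (by
    filter_upwards [hγ.eventually hcrit, hBβ] with u h1 h2 using (h1 h2).2)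
  have hβh : ∀ᶠ u in 𝓝 0, h (u, β u) = β u := by
    filter_upwards [hγ.eventually hcrit, hBβ] with u h1 h2 using (h1 h2).1
  have heq' : ∀ᶠ q in 𝓝 ((0, 0) : ℝ × ℝ), h q = β q.1 + (q.2 - β q.1) ^ 2 * Q q := by
    filter_upwards [heq, eventually_fst hβh] with q h1 h2
    rw [h1, h2]
  have hQ0 : Q (0, 0) ≠ 0 := by
    intro h0
    rw [h0, mul_zero] at hQd
    exact hnd hQd
  obtain ⟨S, hS, hβS, hS0⟩ := implicit_curve_order hB hBv hβ hβ0 hBβ hk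
  exact ⟨hasSmallDifferential_of_eventuallyEq hβ hS hβS hQ heq', fun hne =>
    hasASingularity_of_eventuallyEq hβ hS (fun h => hne (hS0 h)) hβS hQ hQ0 heq'⟩

end NormalForm

/-! ### Rules for partial derivatives. -/

section PartialDerivativeRules

theorem fderiv_apply_eq_du_add_dv {F : ℝ × ℝ → ℝ} {q : ℝ × ℝ} (w : ℝ × ℝ) :
    fderiv ℝ F q w = w.1 * du F q + w.2 * dv F q := by
  have : w = w.1 • ((1 : ℝ), (0 : ℝ)) + w.2 • ((0 : ℝ), (1 : ℝ)) := by simp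
  conv_lhs => rw [this, map_add, map_smul, map_smul]
  rfl

theorem du_congr {V : Type*} [NormedAddCommGroup V] [NormedSpace ℝ V] {F G : ℝ × ℝ → V}
    {q : ℝ × ℝ} (h : F =ᶠ[𝓝 q] G) : du F q = du G q := by
  rw [du, du, h.fderiv_eq]

theorem dv_congr {V : Type*} [NormedAddCommGroup V] [NormedSpace ℝ V] {F G : ℝ × ℝ → V}
    {q : ℝ × ℝ} (h : F =ᶠ[𝓝 q] G) : dv F q = dv G q := by
  rw [dv, dv, h.fderiv_eq]

/-- Mixed partial derivatives of a smooth germ commute. -/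
theorem SmoothNear.dv_du {F : ℝ × ℝ → ℝ} {q : ℝ × ℝ} (hF : SmoothNear F q) :
    dv (du F) q = du (dv F) q := by
  have hsymm : IsSymmSndFDerivAt ℝ F q := hF.contDiffAt.isSymmSndFDerivAt (by simpa using WithTop.coe_le_coe.2 (le_top (a := (2 : ℕ∞))))
  have h : ∀ w w' : ℝ × ℝ,
      fderiv ℝ (fun x => fderiv ℝ F x w) q w' = fderiv ℝ (fderiv ℝ F) q w' w := fun w w' => by
    have := hF.fderiv.differentiableAt.hasFDerivAt.clm_apply (hasFDerivAt_const w q)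
    rw [this.fderiv]
    simp
  have h1 := h (1, 0) (0, 1)
  have h2 := h (0, 1) (1, 0)
  exact h1.trans ((hsymm _ _).trans h2.symm)

theorem SmoothNear.hasDerivAt_comp {F : ℝ × ℝ → ℝ} {γ₁ γ₂ : ℝ → ℝ} {a b t : ℝ}
    (hF : SmoothNear F (γ₁ t, γ₂ t)) (h₁ : HasDerivAt γ₁ a t) (h₂ : HasDerivAt γ₂ b t) :
    HasDerivAt (fun t => F (γ₁ t, γ₂ t)) (a * du F (γ₁ t, γ₂ t) + b * dv F (γ₁ t, γ₂ t)) t := by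
  have := hF.differentiableAt.hasFDerivAt.comp_hasDerivAt t (h₁.prodMk h₂)
  rwa [fderiv_apply_eq_du_add_dv] at this

theorem SmoothNear.hasDerivAt_snd_line {F : ℝ × ℝ → ℝ} {u v : ℝ} (hF : SmoothNear F (u, v)) :
    HasDerivAt (fun t => F (u, t)) (dv F (u, v)) v := by
  simpa using SmoothNear.hasDerivAt_comp (γ₁ := fun _ => u) (γ₂ := fun t => t) hF
    (hasDerivAt_const v u) (hasDerivAt_id v)

theorem SmoothNear.iteratedDeriv_two_snd_line {F : ℝ × ℝ → ℝ} (hF : SmoothNear F (0, 0)) :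
    iteratedDeriv 2 (fun t => F (0, t)) 0 = dv (dv F) (0, 0) := by
  have hv : Tendsto (fun v : ℝ => ((0 : ℝ), v)) (𝓝 0) (𝓝 (0, 0)) :=
    Continuous.tendsto' (by fun_prop) _ _ rfl
  have h : deriv (fun t => F (0, t)) =ᶠ[𝓝 0] fun t => dv F (0, t) := by
    filter_upwards [hv.eventually hF.eventually_smoothNear] with t ht
    exact ht.hasDerivAt_snd_line.deriv
  rw [iteratedDeriv_succ', h.iteratedDeriv_eq, iteratedDeriv_one]
  exact hF.dv.hasDerivAt_snd_line.deriv

theorem du_apply {X : ℝ × ℝ → Vec3} {q : ℝ × ℝ} (hX : DifferentiableAt ℝ X q) (i : Fin 3) :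
    du X q i = du (fun x => X x i) q := by
  have := (hasFDerivAt_pi'.1 hX.hasFDerivAt) i
  rw [du, du, this.fderiv]
  rfl

theorem dv_apply {X : ℝ × ℝ → Vec3} {q : ℝ × ℝ} (hX : DifferentiableAt ℝ X q) (i : Fin 3) :
    dv X q i = dv (fun x => X x i) q := by
  have := (hasFDerivAt_pi'.1 hX.hasFDerivAt) i
  rw [dv, dv, this.fderiv]
  rfl

theorem differentiableAt_vec3 {a b c : ℝ × ℝ → ℝ} {q : ℝ × ℝ} (ha : DifferentiableAt ℝ a q)
    (hb : DifferentiableAt ℝ b q) (hc : DifferentiableAt ℝ c q) :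
    DifferentiableAt ℝ (fun x => (![a x, b x, c x] : Vec3)) q := by
  refine differentiableAt_pi.2 fun i => ?_
  fin_cases i <;> simpa

theorem du_vec3 {a b c : ℝ × ℝ → ℝ} {q : ℝ × ℝ} (ha : DifferentiableAt ℝ a q)
    (hb : DifferentiableAt ℝ b q) (hc : DifferentiableAt ℝ c q) :
    du (fun x => (![a x, b x, c x] : Vec3)) q = ![du a q, du b q, du c q] := by
  ext i
  rw [du_apply (differentiableAt_vec3 ha hb hc)]
  fin_cases i <;> simp

theorem dv_vec3 {a b c : ℝ × ℝ → ℝ} {q : ℝ × ℝ} (ha : DifferentiableAt ℝ a q)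
    (hb : DifferentiableAt ℝ b q) (hc : DifferentiableAt ℝ c q) :
    dv (fun x => (![a x, b x, c x] : Vec3)) q = ![dv a q, dv b q, dv c q] := by
  ext i
  rw [dv_apply (differentiableAt_vec3 ha hb hc)]
  fin_cases i <;> simp

@[simp] theorem du_const (c : ℝ) (q : ℝ × ℝ) : du (fun _ : ℝ × ℝ => c) q = 0 := by simp [du]

@[simp] theorem dv_const (c : ℝ) (q : ℝ × ℝ) : dv (fun _ : ℝ × ℝ => c) q = 0 := by simp [dv]

@[simp] theorem du_fst (q : ℝ × ℝ) : du (fun x : ℝ × ℝ => x.1) q = 1 := by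
  simp [du, hasFDerivAt_fst.fderiv]

@[simp] theorem dv_fst (q : ℝ × ℝ) : dv (fun x : ℝ × ℝ => x.1) q = 0 := by
  simp [dv, hasFDerivAt_fst.fderiv]

@[simp] theorem du_snd (q : ℝ × ℝ) : du (fun x : ℝ × ℝ => x.2) q = 0 := by
  simp [du, hasFDerivAt_snd.fderiv]

@[simp] theorem dv_snd (q : ℝ × ℝ) : dv (fun x : ℝ × ℝ => x.2) q = 1 := by
  simp [dv, hasFDerivAt_snd.fderiv]

end PartialDerivativeRules

/-! ### Fundamental quantities and evolutoid of a Monge surface. -/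

section MongeForm

theorem du_mongeSurface {f : ℝ × ℝ → ℝ} {q : ℝ × ℝ} (hf : SmoothNear f q) :
    du (mongeSurface f) q = ![1, 0, du f q] := by
  have := du_vec3 (q := q) differentiableAt_fst differentiableAt_snd hf.differentiableAt
  rwa [du_fst, du_snd] at this

theorem dv_mongeSurface {f : ℝ × ℝ → ℝ} {q : ℝ × ℝ} (hf : SmoothNear f q) :
    dv (mongeSurface f) q = ![0, 1, dv f q] := by
  have := dv_vec3 (q := q) differentiableAt_fst differentiableAt_snd hf.differentiableAt
  rwa [dv_fst, dv_snd] at this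

theorem dv_dv_mongeSurface {f : ℝ × ℝ → ℝ} {q : ℝ × ℝ} (hf : SmoothNear f q) :
    dv (dv (mongeSurface f)) q = ![0, 0, dv (dv f) q] := by
  have h : dv (mongeSurface f) =ᶠ[𝓝 q] fun x => ![0, 1, dv f x] := by
    filter_upwards [hf.eventually_smoothNear] with x hx using dv_mongeSurface hx
  rw [dv_congr h, dv_vec3 (by fun_prop) (by fun_prop) hf.dv.differentiableAt, dv_const, dv_const]

theorem coeffE_mongeSurface {f : ℝ × ℝ → ℝ} {q : ℝ × ℝ} (hf : SmoothNear f q) :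
    coeffE (mongeSurface f) q = 1 + du f q ^ 2 := by
  simp [coeffE, du_mongeSurface hf]
  ring

theorem coeffG_mongeSurface {f : ℝ × ℝ → ℝ} {q : ℝ × ℝ} (hf : SmoothNear f q) :
    coeffG (mongeSurface f) q = 1 + dv f q ^ 2 := by
  simp [coeffG, dv_mongeSurface hf]
  ring

theorem du_coeffG_mongeSurface {f : ℝ × ℝ → ℝ} {q : ℝ × ℝ} (hf : SmoothNear f q) :
    du (coeffG (mongeSurface f)) q = 2 * dv f q * du (dv f) q := by
  have h : coeffG (mongeSurface f) =ᶠ[𝓝 q] fun x => 1 + dv f x ^ 2 := by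
    filter_upwards [hf.eventually_smoothNear] with x hx using coeffG_mongeSurface hx
  rw [du_congr h]
  have := (hf.dv.differentiableAt.hasFDerivAt.pow 2).const_add 1
  rw [du, HasFDerivAt.fderiv this]
  simp [du]

theorem unitNormal_mongeSurface {f : ℝ × ℝ → ℝ} {q : ℝ × ℝ} (hf : SmoothNear f q) :
    unitNormal (mongeSurface f) q =
      (√(du f q ^ 2 + dv f q ^ 2 + 1))⁻¹ • ![-du f q, -dv f q, 1] := by
  have : crossProduct (du (mongeSurface f) q) (dv (mongeSurface f) q) =
      ![-du f q, -dv f q, 1] := by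
    rw [du_mongeSurface hf, dv_mongeSurface hf, cross_apply]
    simp
  rw [unitNormal, this]
  congr 3
  simp
  ring

theorem coeffg_mongeSurface {f : ℝ × ℝ → ℝ} {q : ℝ × ℝ} (hf : SmoothNear f q) :
    coeffg (mongeSurface f) q = dv (dv f) q / √(du f q ^ 2 + dv f q ^ 2 + 1) := by
  simp [coeffg, dv_dv_mongeSurface hf, unitNormal_mongeSurface hf]
  ring

/-- The radius of the evolutoid of a Monge surface as a function of `f_u, f_v, f_vv, f_uv`. -/
noncomputable def mongeRadius (α A B C D : ℝ) : ℝ :=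
  -(2 * √(1 + A ^ 2) * (1 + B ^ 2)) /
    (Real.cos α * (2 * B * D) -
      2 * Real.sin α * √(1 + A ^ 2) * (1 + B ^ 2) * (C / √(A ^ 2 + B ^ 2 + 1) / (1 + B ^ 2)))

theorem evolutoidRadius_mongeSurface {f : ℝ × ℝ → ℝ} {q : ℝ × ℝ} (hf : SmoothNear f q) (α : ℝ) :
    evolutoidRadius (mongeSurface f) α q =
      mongeRadius α (du f q) (dv f q) (dv (dv f) q) (du (dv f) q) := by
  rw [evolutoidRadius, kappa2, coeffE_mongeSurface hf, coeffG_mongeSurface hf,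
    du_coeffG_mongeSurface hf, coeffg_mongeSurface hf, mongeRadius]

theorem evolutoid_mongeSurface {f : ℝ × ℝ → ℝ} {q : ℝ × ℝ} (hf : SmoothNear f q) (α : ℝ) :
    evolutoid (mongeSurface f) α q =
      ![q.1 + evolutoidRadius (mongeSurface f) α q * (Real.cos α / √(1 + du f q ^ 2) +
          Real.sin α * ((√(du f q ^ 2 + dv f q ^ 2 + 1))⁻¹ * -du f q)),
        q.2 - dv f q * (evolutoidRadius (mongeSurface f) α q * Real.sin α /
          √(du f q ^ 2 + dv f q ^ 2 + 1)),
        f q + evolutoidRadius (mongeSurface f) α q * (Real.cos α / √(1 + du f q ^ 2) * du f q +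
          Real.sin α * (√(du f q ^ 2 + dv f q ^ 2 + 1))⁻¹)] := by
  rw [evolutoid, coeffE_mongeSurface hf, unitNormal_mongeSurface hf, du_mongeSurface hf]
  ext i
  fin_cases i
  · simp [mongeSurface]
  · simp [mongeSurface]
    ring
  · simp [mongeSurface]

/-- This is the value of the factor `K` at points where `f_v = 0`: there the `cos α` term drops out
and the square roots cancel. -/
theorem mongeRadius_of_eq_zero {α A C D : ℝ} (hα : Real.sin α ≠ 0) (hC : C ≠ 0) :
    mongeRadius α A 0 C D * Real.sin α / √(A ^ 2 + 0 ^ 2 + 1) = 1 / C := by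
  have h1 : √(1 + A ^ 2) ≠ 0 := (Real.sqrt_pos.2 (by positivity)).ne'
  have h2 : √(A ^ 2 + 0 ^ 2 + 1) ≠ 0 := (Real.sqrt_pos.2 (by positivity)).ne'
  rw [mongeRadius]
  generalize √(A ^ 2 + 0 ^ 2 + 1) = W at *
  generalize √(1 + A ^ 2) = e at *
  field_simp
  ring

theorem hasDerivAt_sqrt_one_add {A : ℝ → ℝ} (hA0 : A 0 = 0) (hA : HasDerivAt A 0 0) :
    HasDerivAt (fun t => √(1 + A t ^ 2)) 0 0 := by
  have := ((hA.fun_pow 2).const_add 1).sqrt (by simp [hA0])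
  simpa using this

theorem hasDerivAt_sqrt_add_one {A B : ℝ → ℝ} {k : ℝ} (hA0 : A 0 = 0) (hA : HasDerivAt A 0 0)
    (hB0 : B 0 = 0) (hB : HasDerivAt B k 0) :
    HasDerivAt (fun t => √(A t ^ 2 + B t ^ 2 + 1)) 0 0 := by
  have := (((hA.fun_pow 2).fun_add (hB.fun_pow 2)).add_const 1).sqrt (by simp [hA0, hB0])
  simpa [hB0] using this

/-- All square roots and `1 + B²` are stationary at `0`, and `B D` vanishes to second order, so to
first order the radius is `1 / (C sin α)`. -/
theorem hasDerivAt_mongeRadius {α k c d : ℝ} {A B C D : ℝ → ℝ} (hα : Real.sin α ≠ 0)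
    (hk : k ≠ 0) (hA0 : A 0 = 0) (hB0 : B 0 = 0) (hC0 : C 0 = k) (hD0 : D 0 = 0)
    (hA : HasDerivAt A 0 0) (hB : HasDerivAt B k 0) (hC : HasDerivAt C c 0)
    (hD : HasDerivAt D d 0) :
    HasDerivAt (fun t => mongeRadius α (A t) (B t) (C t) (D t))
      (-c / (k ^ 2 * Real.sin α)) 0 := by
  have he := hasDerivAt_sqrt_one_add hA0 hA
  have hW := hasDerivAt_sqrt_add_one hA0 hA hB0 hB
  have hG := (hB.fun_pow 2).const_add 1
  have hnum := ((he.const_mul 2).fun_mul hG).fun_neg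
  have hden := (((hB.const_mul 2).fun_mul hD).const_mul (Real.cos α)).fun_sub
    (((he.const_mul (2 * Real.sin α)).fun_mul hG).fun_mul
      ((hC.fun_div hW (by simp [hA0, hB0])).fun_div hG (by simp [hB0])))
  refine (hnum.fun_div hden (by simp [hA0, hB0, hC0, hα, hk])).congr_deriv ?_
  simp [hA0, hB0, hC0, hD0]
  field_simp

end MongeForm

/-! ### The second coordinate of the evolutoid and the regularity condition. -/

section Evolutoid

variable {f : ℝ × ℝ → ℝ} {α : ℝ}

theorem tendsto_snd_line : Tendsto (fun v : ℝ => ((0 : ℝ), v)) (𝓝 0) (𝓝 (0, 0)) :=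
  Continuous.tendsto' (by fun_prop) _ _ rfl

theorem smoothNear_mongeRadius {A B C D : ℝ × ℝ → ℝ} {q : ℝ × ℝ} (hA : SmoothNear A q)
    (hB : SmoothNear B q) (hC : SmoothNear C q) (hD : SmoothNear D q) (hB0 : B q = 0)
    (hα : Real.sin α ≠ 0) (hC0 : C q ≠ 0) :
    SmoothNear (fun x => mongeRadius α (A x) (B x) (C x) (D x)) q := by
  have h1 : 1 + A q ^ 2 ≠ 0 := by positivity
  have h2 : A q ^ 2 + B q ^ 2 + 1 ≠ 0 := by positivity
  have he : SmoothNear (fun x => √(1 + A x ^ 2)) q :=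
    ((smoothNear_const _ _).add (hA.pow 2)).sqrt h1
  have hW : SmoothNear (fun x => √(A x ^ 2 + B x ^ 2 + 1)) q :=
    (((hA.pow 2).add (hB.pow 2)).add (smoothNear_const _ _)).sqrt h2
  have hG : SmoothNear (fun x => 1 + B x ^ 2) q := (smoothNear_const _ _).add (hB.pow 2)
  have h1' : √(1 + A q ^ 2) ≠ 0 := (Real.sqrt_pos.2 (by positivity)).ne'
  have h2' : √(A q ^ 2 + B q ^ 2 + 1) ≠ 0 := (Real.sqrt_pos.2 (by positivity)).ne'
  have h3' : 1 + B q ^ 2 ≠ 0 := by positivity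
  refine SmoothNear.div ?_ ?_ ?_
  · exact (((smoothNear_const _ _).mul he).mul hG).neg
  · exact ((smoothNear_const _ _).mul (((smoothNear_const _ _).mul hB).mul hD)).sub
      ((((smoothNear_const _ _).mul he).mul hG).mul ((hC.div hW h2').div hG h3'))
  · rw [hB0] at h2' ⊢
    simp only [mul_zero, zero_mul, zero_sub, ne_eq, neg_eq_zero]
    simp only [not_or, mul_eq_zero, div_eq_zero_iff]
    simp [hα, hC0, h1']
    simpa using h2'

theorem evolutoidRadius_eventuallyEq (hf : SmoothNear f (0, 0)) :
    evolutoidRadius (mongeSurface f) α =ᶠ[𝓝 (0, 0)]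
      fun q => mongeRadius α (du f q) (dv f q) (dv (dv f) q) (du (dv f) q) := by
  filter_upwards [hf.eventually_smoothNear] with q hq using evolutoidRadius_mongeSurface hq α

theorem smoothNear_evolutoidRadius (hf : SmoothNear f (0, 0)) (hα : Real.sin α ≠ 0)
    (hfv : dv f (0, 0) = 0) (hk : dv (dv f) (0, 0) ≠ 0) :
    SmoothNear (evolutoidRadius (mongeSurface f) α) (0, 0) :=
  (smoothNear_mongeRadius hf.du hf.dv hf.dv.dv hf.dv.du hfv hα hk).congr
    (evolutoidRadius_eventuallyEq hf)

/-- The factor `K` in the second coordinate `v - f_v K` of the evolutoid. -/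
noncomputable def evolutoidFactor (f : ℝ × ℝ → ℝ) (α : ℝ) (q : ℝ × ℝ) : ℝ :=
  evolutoidRadius (mongeSurface f) α q * Real.sin α / √(du f q ^ 2 + dv f q ^ 2 + 1)

theorem evolutoid_snd (hf : SmoothNear f (0, 0)) :
    (fun q => evolutoid (mongeSurface f) α q 1) =ᶠ[𝓝 (0, 0)]
      fun q => q.2 - dv f q * evolutoidFactor f α q := by
  filter_upwards [hf.eventually_smoothNear] with q hq
  rw [evolutoid_mongeSurface hq α]
  rfl

theorem smoothNear_evolutoidFactor (hf : SmoothNear f (0, 0)) (hα : Real.sin α ≠ 0)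
    (hfv : dv f (0, 0) = 0) (hk : dv (dv f) (0, 0) ≠ 0) :
    SmoothNear (evolutoidFactor f α) (0, 0) :=
  ((smoothNear_evolutoidRadius hf hα hfv hk).mul (smoothNear_const _ _)).div
    ((((hf.du.pow 2).add (hf.dv.pow 2)).add (smoothNear_const _ _)).sqrt (by positivity))
    (Real.sqrt_pos.2 (by positivity)).ne'

theorem smoothNear_evolutoid_snd (hf : SmoothNear f (0, 0)) (hα : Real.sin α ≠ 0)
    (hfv : dv f (0, 0) = 0) (hk : dv (dv f) (0, 0) ≠ 0) :
    SmoothNear (fun q => evolutoid (mongeSurface f) α q 1) (0, 0) :=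
  ((smoothNear_snd _).sub (hf.dv.mul (smoothNear_evolutoidFactor hf hα hfv hk))).congr
    (evolutoid_snd hf)

theorem evolutoidFactor_of_dv_eq_zero {q : ℝ × ℝ} (hf : SmoothNear f q) (hα : Real.sin α ≠ 0)
    (hfv : dv f q = 0) (hk : dv (dv f) q ≠ 0) :
    evolutoidFactor f α q = 1 / dv (dv f) q := by
  rw [evolutoidFactor, evolutoidRadius_mongeSurface hf, hfv, mongeRadius_of_eq_zero hα hk]

theorem SmoothNear.dv_snd_sub_mul {q : ℝ × ℝ} {B K : ℝ × ℝ → ℝ} (hB : SmoothNear B q)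
    (hK : SmoothNear K q) :
    dv (fun x => x.2 - B x * K x) q = 1 - (dv B q * K q + B q * dv K q) := by
  have := hasFDerivAt_snd.fun_sub (hB.differentiableAt.hasFDerivAt.fun_mul hK.differentiableAt.hasFDerivAt)
  rw [dv, HasFDerivAt.fderiv this]
  simp [dv]
  ring

theorem dv_evolutoid_snd (hf : SmoothNear f (0, 0)) (hα : Real.sin α ≠ 0)
    (hfv : dv f (0, 0) = 0) (hk : dv (dv f) (0, 0) ≠ 0) :
    dv (fun q => evolutoid (mongeSurface f) α q 1) =ᶠ[𝓝 (0, 0)]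
      fun q => 1 - (dv (dv f) q * evolutoidFactor f α q + dv f q * dv (evolutoidFactor f α) q) := by
  filter_upwards [eventually_eventually_nhds.2 (evolutoid_snd (α := α) hf),
    hf.eventually_smoothNear,
    (smoothNear_evolutoidFactor hf hα hfv hk).eventually_smoothNear] with q h1 h2 h3
  rw [dv_congr h1, h2.dv.dv_snd_sub_mul h3]

/-- On `f_v = 0`, both `H = v - f_v K` and `H_v = 1 - f_vv K - f_v K_v` simplify, and `K = 1 /
f_vv`. -/
theorem evolutoid_snd_critical (hf : SmoothNear f (0, 0)) (hα : Real.sin α ≠ 0)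
    (hfv : dv f (0, 0) = 0) (hk : dv (dv f) (0, 0) ≠ 0) :
    ∀ᶠ q in 𝓝 ((0, 0) : ℝ × ℝ), dv f q = 0 → evolutoid (mongeSurface f) α q 1 = q.2 ∧
      dv (fun q => evolutoid (mongeSurface f) α q 1) q = 0 := by
  filter_upwards [evolutoid_snd (α := α) hf, dv_evolutoid_snd hf hα hfv hk,
    hf.eventually_smoothNear, hf.dv.dv.continuousAt.eventually_ne hk] with q h1 h2 h3 h4 h5
  rw [h2, evolutoidFactor_of_dv_eq_zero h3 hα h5 h4]
  refine ⟨by simpa [h5] using h1, ?_⟩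
  rw [h5]
  field_simp
  ring

theorem IsMongeFunction.dv_eq_zero (hf : IsMongeFunction f) : dv f (0, 0) = 0 := hf.2.2.2.1

theorem IsMongeFunction.du_eq_zero (hf : IsMongeFunction f) : du f (0, 0) = 0 := hf.2.2.1

theorem IsMongeFunction.du_dv_eq_zero (hf : IsMongeFunction f) : du (dv f) (0, 0) = 0 :=
  hf.2.2.2.2

theorem IsMongeFunction.hasDerivAt_du (hf : IsMongeFunction f) :
    HasDerivAt (fun t => du f (0, t)) 0 0 := by
  have h := hf.1.du.hasDerivAt_snd_line
  rwa [hf.1.dv_du, hf.du_dv_eq_zero] at h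

theorem IsMongeFunction.hasDerivAt_evolutoidRadius (hf : IsMongeFunction f)
    (hα : Real.sin α ≠ 0) (hk : dv (dv f) (0, 0) ≠ 0) :
    HasDerivAt (fun t => evolutoidRadius (mongeSurface f) α (0, t))
      (-dv (dv (dv f)) (0, 0) / (dv (dv f) (0, 0) ^ 2 * Real.sin α)) 0 :=
  (hasDerivAt_mongeRadius (A := fun t => du f (0, t)) (B := fun t => dv f (0, t))
    (C := fun t => dv (dv f) (0, t)) (D := fun t => du (dv f) (0, t)) hα hk hf.du_eq_zero
    hf.dv_eq_zero rfl hf.du_dv_eq_zero hf.hasDerivAt_du hf.1.dv.hasDerivAt_snd_line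
    hf.1.dv.dv.hasDerivAt_snd_line hf.1.dv.du.hasDerivAt_snd_line).congr_of_eventuallyEq
    (tendsto_snd_line.eventually (evolutoidRadius_eventuallyEq hf.1))

theorem IsMongeFunction.evolutoidRadius_zero (hf : IsMongeFunction f) :
    evolutoidRadius (mongeSurface f) α (0, 0) = 1 / (dv (dv f) (0, 0) * Real.sin α) := by
  rw [evolutoidRadius_mongeSurface hf.1, mongeRadius, hf.du_eq_zero, hf.dv_eq_zero]
  simp
  rw [div_eq_mul_inv, mul_inv, mul_inv]
  ring

theorem IsMongeFunction.hasDerivAt_sqrt (hf : IsMongeFunction f) :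
    HasDerivAt (fun t => √(du f (0, t) ^ 2 + dv f (0, t) ^ 2 + 1)) 0 0 :=
  hasDerivAt_sqrt_add_one (A := fun t => du f (0, t)) (B := fun t => dv f (0, t))
    hf.du_eq_zero hf.hasDerivAt_du hf.dv_eq_zero hf.1.dv.hasDerivAt_snd_line

theorem IsMongeFunction.dv_evolutoidFactor (hf : IsMongeFunction f) (hα : Real.sin α ≠ 0)
    (hk : dv (dv f) (0, 0) ≠ 0) :
    dv (evolutoidFactor f α) (0, 0) = -dv (dv (dv f)) (0, 0) / dv (dv f) (0, 0) ^ 2 := by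
  have h := ((hf.hasDerivAt_evolutoidRadius hα hk).mul_const (Real.sin α)).fun_div
    hf.hasDerivAt_sqrt (Real.sqrt_pos.2 (by positivity)).ne'
  have h' := (smoothNear_evolutoidFactor hf.1 hα hf.dv_eq_zero hk).hasDerivAt_snd_line
  rw [h'.unique h]
  simp [hf.du_eq_zero, hf.dv_eq_zero]
  field_simp

theorem IsMongeFunction.dv_dv_evolutoid_snd (hf : IsMongeFunction f) (hα : Real.sin α ≠ 0)
    (hk : dv (dv f) (0, 0) ≠ 0) :
    dv (dv (fun q => evolutoid (mongeSurface f) α q 1)) (0, 0) =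
      dv (dv (dv f)) (0, 0) / dv (dv f) (0, 0) := by
  have hK := smoothNear_evolutoidFactor hf.1 hα hf.dv_eq_zero hk
  have h := ((hf.1.dv.dv.differentiableAt.hasFDerivAt.fun_mul
    hK.differentiableAt.hasFDerivAt).fun_add (hf.1.dv.differentiableAt.hasFDerivAt.fun_mul
    hK.dv.differentiableAt.hasFDerivAt)).const_sub 1
  rw [dv_congr (dv_evolutoid_snd hf.1 hα hf.dv_eq_zero hk), dv, HasFDerivAt.fderiv h]
  have e1 := hf.dv_evolutoidFactor hα hk
  have e2 := evolutoidFactor_of_dv_eq_zero hf.1 hα hf.dv_eq_zero hk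
  change -((dv (dv f) (0, 0) * dv (evolutoidFactor f α) (0, 0) +
    evolutoidFactor f α (0, 0) * dv (dv (dv f)) (0, 0)) +
    (dv f (0, 0) * dv (dv (evolutoidFactor f α)) (0, 0) +
    dv (evolutoidFactor f α) (0, 0) * dv (dv f) (0, 0))) = _
  rw [e1, e2, hf.dv_eq_zero]
  field_simp
  ring

/-- The evolutoid of a Monge surface is singular at the origin if `f_vvv` vanishes there. -/
theorem IsMongeFunction.dv_dv_dv_ne_zero (hf : IsMongeFunction f) (hα : Real.sin α ≠ 0)
    (hk : dv (dv f) (0, 0) ≠ 0) (hreg : IsRegularAt (evolutoid (mongeSurface f) α) (0, 0)) :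
    dv (dv (dv f)) (0, 0) ≠ 0 := by
  intro hc
  have hr := hf.hasDerivAt_evolutoidRadius hα hk
  have hr0 := hf.evolutoidRadius_zero (α := α)
  rw [hc, neg_zero, zero_div] at hr
  have hA := hf.hasDerivAt_du
  have hB := hf.1.dv.hasDerivAt_snd_line
  have hW := hf.hasDerivAt_sqrt.fun_inv (Real.sqrt_pos.2 (by positivity)).ne'
  have he := (hasDerivAt_const (0 : ℝ) (Real.cos α)).fun_div
    (hasDerivAt_sqrt_one_add (A := fun t => du f (0, t)) hf.du_eq_zero hA)
    (Real.sqrt_pos.2 (by positivity)).ne'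
  -- With `f_vvv = 0` the radius is stationary in `v`. The first and third components then have zero
  -- velocity at the origin, and the second has velocity `1 - f_vv · r sin α = 0`.
  have hY : HasDerivAt (fun t : ℝ => evolutoid (mongeSurface f) α (0, t)) 0 0 := by
    have heq : (fun t : ℝ => evolutoid (mongeSurface f) α (0, t)) =ᶠ[𝓝 0] _ :=
      tendsto_snd_line.eventually ((hf.1.eventually_smoothNear).mono
        fun q hq => evolutoid_mongeSurface hq α)
    refine HasDerivAt.congr_of_eventuallyEq ?_ heq
    refine hasDerivAt_pi.2 fun i => ?_
    fin_cases i
    · refine ((hr.fun_mul (he.fun_add ((hW.fun_mul hA.fun_neg).const_mul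
        (Real.sin α)))).const_add (0 : ℝ)).congr_deriv ?_
      simp [hf.du_eq_zero]
    · refine ((hasDerivAt_id (0 : ℝ)).fun_sub (hB.fun_mul ((hr.mul_const (Real.sin α)).fun_div
        hf.hasDerivAt_sqrt (Real.sqrt_pos.2 (by positivity)).ne'))).congr_deriv ?_
      simp [hf.du_eq_zero, hf.dv_eq_zero, hr0]
      field_simp
      simp
    · refine (hf.1.hasDerivAt_snd_line.fun_add (hr.fun_mul ((he.fun_mul hA).fun_add
        (hW.const_mul (Real.sin α))))).congr_deriv ?_
      simp [hf.du_eq_zero, hf.dv_eq_zero]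
  have hdv : dv (evolutoid (mongeSurface f) α) (0, 0) = 0 := by
    -- Without differentiability `fderiv` is `0` by default, so the conclusion holds in either case.
    by_cases hd : DifferentiableAt ℝ (evolutoid (mongeSurface f) α) (0, 0)
    · exact (hd.hasFDerivAt.comp_hasDerivAt (0 : ℝ)
        ((hasDerivAt_const (0 : ℝ) (0 : ℝ)).prodMk (hasDerivAt_id (0 : ℝ)))).unique hY
    · simp [dv, fderiv_zero_of_not_differentiableAt hd]
  exact hreg.ne_zero 1 hdv

end Evolutoid

/-! ### The Hessian of a graph at a parabolic point. -/

section GraphOverPlane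

theorem opNorm_le_abs_add_abs (L : ℝ × ℝ →L[ℝ] ℝ) : ‖L‖ ≤ |L (1, 0)| + |L (0, 1)| := by
  refine L.opNorm_le_bound (by positivity) fun w => ?_
  have : L w = w.1 * L (1, 0) + w.2 * L (0, 1) := by
    have : w = w.1 • ((1 : ℝ), (0 : ℝ)) + w.2 • ((0 : ℝ), (1 : ℝ)) := by simp
    conv_lhs => rw [this, map_add, map_smul, map_smul]
    rfl
  have h1 : |w.1| ≤ ‖w‖ := norm_fst_le w
  have h2 : |w.2| ≤ ‖w‖ := norm_snd_le w
  rw [this]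
  calc _ ≤ |w.1| * |L (1, 0)| + |w.2| * |L (0, 1)| := by
        rw [← abs_mul, ← abs_mul]; exact abs_add_le _ _
    _ ≤ ‖w‖ * |L (1, 0)| + ‖w‖ * |L (0, 1)| := by gcongr
    _ = _ := by ring

theorem SmoothNear.comp_line {F : ℝ × ℝ → ℝ} (hF : SmoothNear F (0, 0)) (a b : ℝ) :
    SmoothNear (fun t : ℝ => F (t * a, t * b)) 0 :=
  SmoothNear.comp (F := fun t : ℝ => (t * a, t * b)) (by simpa using hF)
    (ContDiff.smoothNear (by fun_prop) _)

/-- Applied to the first partial derivatives of a germ: hypothesis `h1` says that `(a, b)` is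
annihilated by a row of the Hessian. -/
theorem SmoothNear.isBigO_line {F : ℝ × ℝ → ℝ} (hF : SmoothNear F (0, 0)) {a b : ℝ}
    (h0 : F (0, 0) = 0) (h1 : a * _root_.du F (0, 0) + b * _root_.dv F (0, 0) = 0) :
    (fun t : ℝ => F (t * a, t * b)) =O[𝓝 0] fun t => t ^ 2 := by
  refine (hF.comp_line a b).isBigO_of_pow 2 fun i hi => ?_
  interval_cases i
  · simpa using h0
  · rw [iteratedDeriv_one]
    have := SmoothNear.hasDerivAt_comp (γ₁ := fun t => t * a) (γ₂ := fun t => t * b) (t := 0)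
      (by simpa using hF) (by simpa using (hasDerivAt_id (0 : ℝ)).mul_const a)
      (by simpa using (hasDerivAt_id (0 : ℝ)).mul_const b)
    rw [this.deriv]
    simpa using h1

/-- A germ with vanishing differential and degenerate Hessian has small differential along a
null direction of the Hessian. -/
theorem hasSmallDifferential_two_of_hessian {g : ℝ × ℝ → ℝ} (hg : SmoothNear g (0, 0))
    (h₁ : du g (0, 0) = 0) (h₂ : dv g (0, 0) = 0)
    (hdet : du (du g) (0, 0) * dv (dv g) (0, 0) - du (dv g) (0, 0) ^ 2 = 0) :
    HasSmallDifferential 2 g (0, 0) := by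
  obtain ⟨a, b, hab, e1, e2⟩ : ∃ a b : ℝ, ((a, b) : ℝ × ℝ) ≠ 0 ∧
      a * du (du g) (0, 0) + b * dv (du g) (0, 0) = 0 ∧
      a * du (dv g) (0, 0) + b * dv (dv g) (0, 0) = 0 := by
    rw [hg.dv_du]
    -- If `g_uu = 0`, the determinant forces `g_uv = 0` and `(1, 0)` is a null vector; otherwise
    -- `(-g_uv, g_uu)` is one.
    by_cases h : du (du g) (0, 0) = 0
    · have : du (dv g) (0, 0) = 0 := by simpa [h] using hdet
      exact ⟨1, 0, by simp, by simp [h], by simp [this]⟩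
    · exact ⟨-du (dv g) (0, 0), du (du g) (0, 0), by simp [h], by ring, by linear_combination hdet⟩
  obtain ⟨C₁, hC₁⟩ := (hg.du.isBigO_line h₁ e1).bound
  obtain ⟨C₂, hC₂⟩ := (hg.dv.isBigO_line h₂ e2).bound
  have hn : 0 < ‖((a, b) : ℝ × ℝ)‖ := norm_pos_iff.2 hab
  refine ⟨(C₁ + C₂) / ‖((a, b) : ℝ × ℝ)‖ ^ 2,
    frequently_punctured_of_curve (γ := fun t => t • (a, b)) (by fun_prop) (zero_smul _ _)
    (fun t ht h => ?_) ?_⟩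
  · exact (smul_ne_zero ht hab) h
  · filter_upwards [hC₁, hC₂] with t h1 h2
    have e : ‖t • ((a, b) : ℝ × ℝ) - (0, 0)‖ = |t| * ‖((a, b) : ℝ × ℝ)‖ := by
      have : t • ((a, b) : ℝ × ℝ) - (0, 0) = t • (a, b) := sub_zero _
      rw [this, norm_smul, Real.norm_eq_abs]
    rw [e, mul_pow, div_mul_eq_mul_div, mul_div_assoc, mul_div_cancel_right₀ _ (by positivity)]
    refine (opNorm_le_abs_add_abs _).trans ?_
    rw [Real.norm_eq_abs, Real.norm_eq_abs, abs_pow] at h1 h2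
    rw [add_mul]
    exact add_le_add h1 h2

/-- At a parabolic point of a graph over the `xz`-plane the Hessian is degenerate. -/
theorem hessian_eq_zero_of_isParabolicPoint {ψ : ℝ × ℝ → Vec3} {g : ℝ × ℝ → ℝ} {p : Vec3}
    (hg : SmoothNear g (0, 0)) (h₁ : du g (0, 0) = 0) (h₂ : dv g (0, 0) = 0)
    (hψ : ∀ q, ψ q = p + ![q.1, g q, q.2]) (hpar : IsParabolicPoint ψ (0, 0)) :
    du (du g) (0, 0) * dv (dv g) (0, 0) - du (dv g) (0, 0) ^ 2 = 0 := by
  have hψ' : ψ = fun q => ![p 0 + q.1, p 1 + g q, p 2 + q.2] := by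
    funext q
    rw [hψ]
    ext i
    fin_cases i <;> simp
  have hadd : ∀ (c : ℝ) (F : ℝ × ℝ → ℝ) (q : ℝ × ℝ), du (fun x => c + F x) q = du F q ∧
      dv (fun x => c + F x) q = dv F q := fun c F q => by
    simp [du, dv, fderiv_const_add]
  have hdu : ∀ᶠ q in 𝓝 ((0, 0) : ℝ × ℝ), du ψ q = ![1, du g q, 0] := by
    filter_upwards [hg.eventually_smoothNear] with q hq
    have := hq.differentiableAt
    rw [hψ', du_vec3 (by fun_prop) (by fun_prop) (by fun_prop), (hadd _ _ _).1, (hadd _ _ _).1,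
      (hadd _ _ _).1, du_fst, du_snd]
  have hdv : ∀ᶠ q in 𝓝 ((0, 0) : ℝ × ℝ), dv ψ q = ![0, dv g q, 1] := by
    filter_upwards [hg.eventually_smoothNear] with q hq
    have := hq.differentiableAt
    rw [hψ', dv_vec3 (by fun_prop) (by fun_prop) (by fun_prop), (hadd _ _ _).2, (hadd _ _ _).2,
      (hadd _ _ _).2, dv_fst, dv_snd]
  have hduu : du (du ψ) (0, 0) = ![0, du (du g) (0, 0), 0] := by
    rw [du_congr hdu, du_vec3 (by fun_prop) hg.du.differentiableAt (by fun_prop), du_const, du_const]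
  have hduv : du (dv ψ) (0, 0) = ![0, du (dv g) (0, 0), 0] := by
    rw [du_congr hdv, du_vec3 (by fun_prop) hg.dv.differentiableAt (by fun_prop), du_const, du_const]
  have hdvv : dv (dv ψ) (0, 0) = ![0, dv (dv g) (0, 0), 0] := by
    rw [dv_congr hdv, dv_vec3 (by fun_prop) hg.dv.differentiableAt (by fun_prop), dv_const, dv_const]
  have hdu0 := hdu.self_of_nhds
  have hdv0 := hdv.self_of_nhds
  rw [h₁] at hdu0
  rw [h₂] at hdv0
  have hN : unitNormal ψ (0, 0) = ![0, -1, 0] := by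
    have : crossProduct (du ψ (0, 0)) (dv ψ (0, 0)) = ![0, -1, 0] := by
      rw [hdu0, hdv0, cross_apply]
      simp
    rw [unitNormal, this]
    simp
  rw [IsParabolicPoint, gaussCurvature, coeffe, coeffm, coeffg, coeffE, coeffF, coeffG, hduu, hduv,
    hdvv, hdu0, hdv0, hN] at hpar
  simpa using hpar

end GraphOverPlane

/-! ### The classification of the height function. -/

theorem theorem3 (f : ℝ × ℝ → ℝ) (hf : IsMongeFunction f)
    (hκ₂ : taylorCoeff f 0 2 ≠ 0)
    (α : ℝ) (hα : α ∈ Set.Ioo 0 (Real.pi / 2))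
    (hreg : IsRegularAt (evolutoid (mongeSurface f) α) (0, 0))
    (ψ : ℝ × ℝ → Vec3)
    (hψ : IsMongeParametrizationOf (evolutoid (mongeSurface f) α) ψ)
    (hpar : IsParabolicPoint ψ (0, 0))
    (hasym : IsAsymptoticDirection ψ (0, 0) ![0, 0, 1]) :
    (HasASingularity 2 (heightFunction ψ ![0, 1, 0]) (0, 0) ↔ taylorCoeff f 3 1 ≠ 0) ∧
    (HasASingularity 3 (heightFunction ψ ![0, 1, 0]) (0, 0) ↔
      taylorCoeff f 3 1 = 0 ∧ taylorCoeff f 4 1 ≠ 0) := by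
  have hsin : Real.sin α ≠ 0 :=
    (Real.sin_pos_of_pos_of_lt_pi hα.1 (by linarith [hα.2, Real.pi_pos])).ne'
  have hk : dv (dv f) (0, 0) ≠ 0 := hκ₂
  obtain ⟨⟨g, hg, hg0, hgu, hgv, hψg⟩, θ, hθ0, hθ, hYψ⟩ := hψ
  set H : ℝ × ℝ → ℝ := fun q => evolutoid (mongeSurface f) α q 1 with hH_def
  have hH : SmoothNear H (0, 0) := smoothNear_evolutoid_snd hf.1 hsin hf.dv_eq_zero hk
  have hheight : heightFunction ψ ![0, 1, 0] =
      fun q => evolutoid (mongeSurface f) α (0, 0) 1 + g q := by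
    funext q
    simp [heightFunction, hψg]
    rfl
  have hhs : SmoothNear (heightFunction ψ ![0, 1, 0]) (0, 0) := by
    rw [hheight]
    exact (smoothNear_const _ _).add hg
  have hHh : AEquivalentAt H (0, 0) (heightFunction ψ ![0, 1, 0]) (0, 0) := by
    refine ⟨θ, fun x => x, hθ0, hθ, isLocalDiffeomorphAt_id _, ?_⟩
    filter_upwards [hYψ] with q hq
    simp [hH_def, hq, heightFunction]
    rfl
  have hhH := hHh.symm hhs.continuousAt
  have hA : ∀ k, HasASingularity k (heightFunction ψ ![0, 1, 0]) (0, 0) ↔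
      HasASingularity k H (0, 0) := fun k => ⟨fun h => h.congr hHh, fun h => h.congr hhH⟩
  have hnd : iteratedDeriv 2 (fun v => H (0, v)) 0 ≠ 0 := by
    rw [hH.iteratedDeriv_two_snd_line, hf.dv_dv_evolutoid_snd hsin hk]
    exact div_ne_zero (hf.dv_dv_dv_ne_zero hsin hk hreg) hk
  have hsing := fun k hk' => singularity_of_implicit_curve (k := k) hH hf.1.dv hf.dv_eq_zero hk
    (evolutoid_snd_critical hf.1 hsin hf.dv_eq_zero hk) hnd hk'
  have hsmall : HasSmallDifferential 2 H (0, 0) := by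
    refine .of_aEquivalentAt hHh hhs ?_
    have hdet := hessian_eq_zero_of_isParabolicPoint hg hgu hgv hψg hpar
    obtain ⟨C, hC⟩ := hasSmallDifferential_two_of_hessian hg hgu hgv hdet
    refine ⟨C, hC.mono fun x hx => ?_⟩
    rwa [hheight, fderiv_const_add]
  have h0 : (du^[0] (dv f)) (0, 0) = 0 := hf.dv_eq_zero
  have h1 : (du^[1] (dv f)) (0, 0) = 0 := hf.du_dv_eq_zero
  -- If `a_{21} ≠ 0`, then `H` would be of type `A_1`, whose differential is not of order `2` near
  -- the origin; the degenerate Hessian says that it is.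
  have h2 : (du^[2] (dv f)) (0, 0) = 0 := by
    by_contra h2
    refine ((hsing 1 fun i hi => ?_).2 h2).not_hasSmallDifferential le_rfl hH hsmall
    interval_cases i <;> assumption
  have hs2 := hsing 2 fun i hi => by interval_cases i <;> assumption
  -- When `a_{31} = 0` the critical curve has contact one order higher, so the differential of `H`
  -- is of order `3`, which `A_2` forbids.
  have key3 : (du^[3] (dv f)) (0, 0) = 0 → ¬ HasASingularity 2 H (0, 0) := fun h3 hA2 =>
    hA2.not_hasSmallDifferential one_le_two hH
      (hsing 3 fun i hi => by interval_cases i <;> assumption).1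
  rw [hA, hA]
  change (_ ↔ (du^[3] (dv f)) (0, 0) ≠ 0) ∧
    (_ ↔ (du^[3] (dv f)) (0, 0) = 0 ∧ (du^[4] (dv f)) (0, 0) ≠ 0)
  refine ⟨⟨fun h h3 => key3 h3 h, hs2.2⟩, fun h => ?_, fun ⟨h3, h4⟩ =>
    (hsing 3 fun i hi => by interval_cases i <;> assumption).2 h4⟩
  -- Otherwise `H` would be both `A_2` and `A_3`. In the same way `a_{41} = 0` would give a
  -- differential of order `4`, which `A_3` forbids.
  have h3 : (du^[3] (dv f)) (0, 0) = 0 := by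
    by_contra h3
    exact (hs2.2 h3).not_hasSmallDifferential one_le_two hH h.hasSmallDifferential
  refine ⟨h3, fun h4 => ?_⟩
  exact h.not_hasSmallDifferential (by norm_num) hH
    (hsing 4 fun i hi => by interval_cases i <;> assumption).1
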